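/- Let $m$ and $n$ be positive integers, where $n\ge 4$ is even, and let $0\le \ell\le n/2$ be an integer of the same parity as $m$, where $(m,\ell)\ne(1,1)$. Let $\Gamma=\mathrm{HTG}(m,n,\ell)$ be the honeycomb toroidal graph, that is, the (cubic) graph with vertex set $\{\langle i,j\rangle : i\in\mathbb{Z}_m,\ j\in\mathbb{Z}_n\}$ and the following adjacencies: $\langle i,j\rangle\sim\langle i,j\pm1\rangle$ for all $i\in\mathbb{Z}_m$, $j\in\mathbb{Z}_n$; $\langle i,j\rangle\sim\langle i+1,j\rangle$ for all $i\in\mathbb{Z}_m\setminus\{m-1\}$ and $j\in\mathbb{Z}_n$ with $i$ and $j$ of different parity; and $\langle m-1,j\rangle\sim\langle 0,j+\ell\rangle$ for all $j\in\mathbb{Z}_n$ of the same parity as $m$. (Parities are those of the representatives in $\{0,\dots,m-1\}$ and $\{0,\dots,n-1\}$.) Assume that $\Gamma$ is none of the graphs $\mathrm{HTG}(1,6,3)$, $\mathrm{HTG}(2,4,0)$, $\mathrm{HTG}(2,4,2)$, $\mathrm{HTG}(1,8,3)$, $\mathrm{HTG}(1,14,5)$, $\mathrm{HTG}(1,16,5)$,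 $\mathrm{HTG}(2,8,4)$, $\mathrm{HTG}(3,6,3)$, and that it is not the case that $mn=4n'$ for some integer $n'>2$ where either $n=4$ or $\Gamma\in\{\mathrm{HTG}(1,4n',2n'-1),\mathrm{HTG}(2,2n',2)\}$. Consider the conditions (c1) $\gcd(n,\ell+m)=2m$ and $2mn\mid \ell^2+2m\ell-3m^2$; (c2) $\gcd(n,\ell-m)=2m$ and $2mn\mid \ell^2-2m\ell-3m^2$; (c3) $\ell\in\{0,n/2\}$; (c4) $\gcd(n,\ell+m)=2m=\gcd(n,\ell-m)$ and $2mn\mid \ell^2+3m^2$. For $s\ge1$, an $s$-arc is a sequence of $s+1$ vertices such that any two consecutive ones are adjacent and any three consecutive ones are pairwise distinct; a graph is $s$-arc-transitive (respectively $s$-arc-regular) if its automorphism group acts transitively (respectively regularly) on the set of its $s$-arcs, and arc-transitive means $1$-arc-transitive. Then: 1. $\Gamma$ is $2$-arc-regular if and only if at least two of (c1), (c2), (c3), (c4) hold; in that case all four of them hold; and this occurs if and only if $\Gamma$ is one of $\mathrm{HTG}(m,2m,m)$ with $m\ge4$ and $\mathrm{HTG}(m,6m,3m)$ with $m\ge2$.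 2. $\Gamma$ is $1$-arc-regular if and only if (c4) holds, but none of (c1), (c2), (c3) holds. 3. $\Gamma$ is not arc-transitive and has vertex stabilizers of order $2$ if and only if precisely one of (c1), (c2), (c3) holds. 4. $\mathrm{Aut}(\Gamma)$ acts regularly on the vertex set of $\Gamma$ if and only if none of (c1), (c2), (c3), (c4) holds. -/

import Mathlib

/-- The honeycomb toroidal graph `HTG(m, n, l)` on the vertex set `ℤ_m × ℤ_n`, with the adjacencies
* `⟨i, j⟩ ∼ ⟨i, j ± 1⟩` for all `i` and `j`;
* `⟨i, j⟩ ∼ ⟨i + 1, j⟩` for `i ≠ m - 1` and `i`, `j` of different parity;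
* `⟨m - 1, j⟩ ∼ ⟨0, j + l⟩` for `j` of the same parity as `m`.
The parity of a residue class is that of its representative in `{0, …, m - 1}`
(respectively `{0, …, n - 1}`). -/
def HTG (m n l : ℕ) : SimpleGraph (ZMod m × ZMod n) :=
  SimpleGraph.fromRel fun u v =>
    (v.1 = u.1 ∧ v.2 = u.2 + 1) ∨
    (u.1.val ≠ m - 1 ∧ u.1.val % 2 ≠ u.2.val % 2 ∧ v.1 = u.1 + 1 ∧ v.2 = u.2) ∨
    (u.1.val = m - 1 ∧ u.2.val % 2 = m % 2 ∧ v.1 = 0 ∧ v.2 = u.2 + (l : ZMod n))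

/-- `a` is an `s`-arc of `G`: a sequence of `s + 1` vertices such that any two consecutive ones are
adjacent and any three consecutive ones are pairwise distinct (adjacent vertices are always
distinct, so it is enough to compare the first and the third). -/
def IsSArc {V : Type*} (G : SimpleGraph V) (s : ℕ) (a : Fin (s + 1) → V) : Prop :=
  (∀ i j : Fin (s + 1), j.val = i.val + 1 → G.Adj (a i) (a j)) ∧
  (∀ i j : Fin (s + 1), j.val = i.val + 2 → a i ≠ a j)

/-- `G` is `s`-arc-transitive: `Aut(G)` acts transitively on the set of all `s`-arcs. -/
def IsSArcTransitive {V : Type*} (G : SimpleGraph V) (s : ℕ) : Prop :=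
  ∀ a b : Fin (s + 1) → V, IsSArc G s a → IsSArc G s b → ∃ φ : G ≃g G, ∀ i, φ (a i) = b i

/-- `G` is `s`-arc-regular: `Aut(G)` acts regularly on the set of all `s`-arcs. -/
def IsSArcRegular {V : Type*} (G : SimpleGraph V) (s : ℕ) : Prop :=
  ∀ a b : Fin (s + 1) → V, IsSArc G s a → IsSArc G s b → ∃! φ : G ≃g G, ∀ i, φ (a i) = b i

/-- `Aut(G)` acts regularly on the vertex set of `G`. -/
def AutRegular {V : Type*} (G : SimpleGraph V) : Prop :=
  ∀ u v : V, ∃! φ : G ≃g G, φ u = v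

/-- All vertex stabilizers in `Aut(G)` have order `k`. -/
def VertexStabilizersOfOrder {V : Type*} (G : SimpleGraph V) (k : ℕ) : Prop :=
  ∀ v : V, Nat.card (MulAction.stabilizer (G ≃g G) v) = k

/-- The parameters of the exceptional honeycomb toroidal graphs: the complete bipartite graph
`K_{3,3}`, the cube, the Heawood graph, the Möbius–Kantor graph, the Pappus graph, and the
generalized prisms `GPr(k)` with `k > 2`. -/
def IsExceptional (m n l : ℕ) : Prop :=
  (m = 1 ∧ n = 6 ∧ l = 3) ∨
  ((m = 2 ∧ n = 4 ∧ l = 0) ∨ (m = 2 ∧ n = 4 ∧ l = 2) ∨ (m = 1 ∧ n = 8 ∧ l = 3)) ∨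
  (m = 1 ∧ n = 14 ∧ l = 5) ∨
  ((m = 1 ∧ n = 16 ∧ l = 5) ∨ (m = 2 ∧ n = 8 ∧ l = 4)) ∨
  (m = 3 ∧ n = 6 ∧ l = 3) ∨
  (∃ k : ℕ, 2 < k ∧ m * n = 4 * k ∧
    (n = 4 ∨ (m = 1 ∧ n = 4 * k ∧ l = 2 * k - 1) ∨ (m = 2 ∧ n = 2 * k ∧ l = 2)))

/-- Condition (c1). -/
def C1 (m n l : ℕ) : Prop :=
  Int.gcd (n : ℤ) ((l : ℤ) + m) = 2 * m ∧
    2 * (m : ℤ) * n ∣ (l : ℤ) ^ 2 + 2 * m * l - 3 * (m : ℤ) ^ 2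

/-- Condition (c2). -/
def C2 (m n l : ℕ) : Prop :=
  Int.gcd (n : ℤ) ((l : ℤ) - m) = 2 * m ∧
    2 * (m : ℤ) * n ∣ (l : ℤ) ^ 2 - 2 * m * l - 3 * (m : ℤ) ^ 2

/-- Condition (c3); here `n` is even, so that `n / 2` is exact. -/
def C3 (n l : ℕ) : Prop := l = 0 ∨ l = n / 2

/-- Condition (c4). -/
def C4 (m n l : ℕ) : Prop :=
  Int.gcd (n : ℤ) ((l : ℤ) + m) = 2 * m ∧ Int.gcd (n : ℤ) ((l : ℤ) - m) = 2 * m ∧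
    2 * (m : ℤ) * n ∣ (l : ℤ) ^ 2 + 3 * (m : ℤ) ^ 2

/-- At least two of the four propositions hold. -/
def AtLeastTwo (p q r s : Prop) : Prop :=
  (p ∧ q) ∨ (p ∧ r) ∨ (p ∧ s) ∨ (q ∧ r) ∨ (q ∧ s) ∨ (r ∧ s)

/-- Precisely one of the three propositions holds. -/
def ExactlyOne (p q r : Prop) : Prop :=
  (p ∧ ¬q ∧ ¬r) ∨ (¬p ∧ q ∧ ¬r) ∨ (¬p ∧ ¬q ∧ r)

/-! The graph is a quotient of the honeycomb lattice by a lattice Λ of translations. In the model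
used here the vertices are the points of `ℤ³` with coordinate sum 0 or 1, the three edge colours are
the coordinate directions, and the symmetric group on the colours acts by permuting coordinates. The
identity colour permutation already gives a vertex-transitive group of symmetries (translations and
point reflections), and these preserve every Λ. The extra symmetries fixing a vertex are therefore
the permutations in S₃ that preserve Λ.

The main point is that outside the exceptional list there are no other automorphisms
(`exists_locallyRigid`, `HoneycombCover.eq_affine`). Any automorphism permutes the colours at each
vertex; counting short closed walks through 3-arcs forces these permutations to agree at adjacent
vertices, so the automorphism lifts to a symmetry of the honeycomb.

It remains to see which permutations preserve Λ. If a permutation moves the third coordinate, its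
preserving Λ forces n = 2mq and l = m + 2mt, and Λ is then m times the set of sum-zero vectors
congruent mod q to a multiple of (t, -(t+1), 1). Invariance becomes a polynomial congruence in t mod
q: the transpositions (1 2), (0 2), (0 1) give (c1), (c2), (c3), and the rotations give (c4). Two of
the conditions generate S₃ and leave only q = 1 or q = 3 (`eq_of_atLeastTwo`). The four claims then
read off the action of a subgroup of S₃ on the three colours. -/

/-! ### The honeycomb lattice and its symmetries. -/

/-- The points of `ℤ³` with coordinate sum `0` or `1`: the vertices of the honeycomb lattice. -/
def IsVertex (p : Fin 3 → ℤ) : Prop := p 0 + p 1 + p 2 = 0 ∨ p 0 + p 1 + p 2 = 1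

/-- The sign of a vertex: `1` if the coordinate sum is `0`, and `-1` if it is `1`. -/
def vsign (p : Fin 3 → ℤ) : ℤ := 1 - 2 * (p 0 + p 1 + p 2)

/-- The neighbour of `p` along the edge of colour `s`. -/
def step (s : Fin 3) (p : Fin 3 → ℤ) : Fin 3 → ℤ := p + Pi.single s (vsign p)

lemma sum_single (s : Fin 3) (x : ℤ) :
    (Pi.single s x : Fin 3 → ℤ) 0 + (Pi.single s x : Fin 3 → ℤ) 1 +
      (Pi.single s x : Fin 3 → ℤ) 2 = x := by
  fin_cases s <;> simp

lemma sum_step (s : Fin 3) (p : Fin 3 → ℤ) :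
    step s p 0 + step s p 1 + step s p 2 = 1 - (p 0 + p 1 + p 2) := by
  have := sum_single s (vsign p)
  simp only [step, Pi.add_apply, vsign] at *
  linarith

lemma IsVertex.step {p : Fin 3 → ℤ} (hp : IsVertex p) (s : Fin 3) : IsVertex (step s p) := by
  have := sum_step s p
  unfold IsVertex at *
  omega

lemma vsign_step (s : Fin 3) (p : Fin 3 → ℤ) : vsign (step s p) = -vsign p := by
  have := sum_step s p
  unfold vsign at *
  omega

lemma step_step (s : Fin 3) (p : Fin 3 → ℤ) : step s (step s p) = p := by
  rw [step, vsign_step, step, add_assoc, ← Pi.single_add]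
  simp

lemma IsVertex.vsign_mul_self {p : Fin 3 → ℤ} (hp : IsVertex p) : vsign p * vsign p = 1 := by
  unfold vsign
  rcases hp with h | h <;> rw [h] <;> norm_num

lemma IsVertex.vsign_eq {p : Fin 3 → ℤ} (hp : IsVertex p) : vsign p = 1 ∨ vsign p = -1 := by
  unfold vsign
  rcases hp with h | h <;> rw [h] <;> norm_num

/-- The symmetry of the honeycomb lattice that maps `p` to `q` and permutes the edge colours
by `σ`. -/
def affine (σ : Equiv.Perm (Fin 3)) (p q r : Fin 3 → ℤ) : Fin 3 → ℤ :=
  fun i => q i + vsign p * vsign q * (r (σ.symm i) - p (σ.symm i))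

lemma sum_perm (σ : Equiv.Perm (Fin 3)) (v : Fin 3 → ℤ) :
    v (σ 0) + v (σ 1) + v (σ 2) = v 0 + v 1 + v 2 := by
  have := Equiv.sum_comp σ v
  simpa [Fin.sum_univ_three] using this

lemma affine_self (σ : Equiv.Perm (Fin 3)) (p q : Fin 3 → ℤ) : affine σ p q p = q := by
  funext i; simp [affine]

lemma sum_affine (σ : Equiv.Perm (Fin 3)) (p q r : Fin 3 → ℤ) :
    affine σ p q r 0 + affine σ p q r 1 + affine σ p q r 2 =
      q 0 + q 1 + q 2 + vsign p * vsign q * (r 0 + r 1 + r 2 - (p 0 + p 1 + p 2)) := by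
  have h1 := sum_perm σ.symm r
  have h2 := sum_perm σ.symm p
  simp only [affine]
  rw [← h1, ← h2]; ring

lemma vsign_affine (σ : Equiv.Perm (Fin 3)) {p q r : Fin 3 → ℤ} (hp : IsVertex p)
    (hq : IsVertex q) : vsign (affine σ p q r) = vsign p * vsign q * vsign r := by
  have h := sum_affine σ p q r
  have e : ∀ x, vsign x = 1 - 2 * (x 0 + x 1 + x 2) := fun _ => rfl
  rw [e (affine σ p q r), h, e p, e q, e r]
  rcases hp with h1 | h1 <;> rcases hq with h2 | h2 <;> rw [h1, h2] <;> ring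

lemma isVertex_affine (σ : Equiv.Perm (Fin 3)) {p q r : Fin 3 → ℤ} (hp : IsVertex p)
    (hq : IsVertex q) (hr : IsVertex r) : IsVertex (affine σ p q r) := by
  have h := vsign_affine σ hp hq (r := r)
  have : vsign (affine σ p q r) = 1 ∨ vsign (affine σ p q r) = -1 := by
    rw [h]
    rcases hp.vsign_eq with h1 | h1 <;> rcases hq.vsign_eq with h2 | h2 <;>
      rcases hr.vsign_eq with h3 | h3 <;> rw [h1, h2, h3] <;> norm_num
  unfold vsign IsVertex at *
  omega

lemma affine_step (σ : Equiv.Perm (Fin 3)) {p q r : Fin 3 → ℤ} (hp : IsVertex p)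
    (hq : IsVertex q) (s : Fin 3) :
    affine σ p q (step s r) = step (σ s) (affine σ p q r) := by
  funext i
  have h : (Pi.single (σ s) (vsign p * vsign q * vsign r) : Fin 3 → ℤ) i =
      vsign p * vsign q * (Pi.single s (vsign r) : Fin 3 → ℤ) (σ.symm i) := by
    simp only [Pi.single_apply, Equiv.symm_apply_eq]
    split_ifs <;> simp
  rw [step.eq_def (σ s), vsign_affine σ hp hq, Pi.add_apply, h]
  simp only [affine, step, Pi.add_apply]
  ring

lemma affine_affine (σ : Equiv.Perm (Fin 3)) {p q : Fin 3 → ℤ} (r : Fin 3 → ℤ) (hp : IsVertex p)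
    (hq : IsVertex q) : affine σ.symm q p (affine σ p q r) = r := by
  funext i
  have h1 := hp.vsign_mul_self
  have h2 := hq.vsign_mul_self
  simp only [affine, Equiv.symm_symm, Equiv.symm_apply_apply]
  linear_combination (r i - p i) * vsign q * vsign q * h1 + (r i - p i) * h2

/-- At a vertex of sum 0 every step raises a coordinate, and some coordinate of `r` lies below that
of `p` because the sum of `r` is not larger; at sum 1 the signs are reversed. -/
lemma exists_step_closer {p r : Fin 3 → ℤ} (hp : IsVertex p) (hr : IsVertex r) (h : r ≠ p) :
    ∃ s, (step s r 0 - p 0).natAbs + (step s r 1 - p 1).natAbs + (step s r 2 - p 2).natAbs <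
      (r 0 - p 0).natAbs + (r 1 - p 1).natAbs + (r 2 - p 2).natAbs := by
  have hne : ¬ (r 0 = p 0 ∧ r 1 = p 1 ∧ r 2 = p 2) := by
    rintro ⟨h0, h1, h2⟩
    exact h (by funext i; fin_cases i <;> assumption)
  unfold IsVertex at *
  rcases hr with hr | hr
  · have hs : vsign r = 1 := by unfold vsign; omega
    have : r 0 < p 0 ∨ r 1 < p 1 ∨ r 2 < p 2 := by omega
    rcases this with h | h | h
    · exact ⟨0, by simp [step, hs]; omega⟩
    · exact ⟨1, by simp [step, hs]; omega⟩
    · exact ⟨2, by simp [step, hs]; omega⟩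
  · have hs : vsign r = -1 := by unfold vsign; omega
    have : p 0 < r 0 ∨ p 1 < r 1 ∨ p 2 < r 2 := by omega
    rcases this with h | h | h
    · exact ⟨0, by simp [step, hs]; omega⟩
    · exact ⟨1, by simp [step, hs]; omega⟩
    · exact ⟨2, by simp [step, hs]; omega⟩

/-- The honeycomb lattice is connected, as an induction principle. -/
lemma isVertex_induction {p : Fin 3 → ℤ} (hp : IsVertex p) {Q : (Fin 3 → ℤ) → Prop} (h0 : Q p)
    (hstep : ∀ r s, IsVertex r → Q r → Q (step s r)) : ∀ r, IsVertex r → Q r := by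
  suffices H : ∀ (N : ℕ) (r : Fin 3 → ℤ), IsVertex r →
      (r 0 - p 0).natAbs + (r 1 - p 1).natAbs + (r 2 - p 2).natAbs < N → Q r from
    fun r hr => H _ r hr (Nat.lt_succ_self _)
  intro N
  induction N with
  | zero => intro r _ h; omega
  | succ N ih =>
    intro r hr h
    by_cases hrp : r = p
    · rw [hrp]; exact h0
    · obtain ⟨s, hs⟩ := exists_step_closer hp hr hrp
      have := hstep _ s (hr.step s) (ih _ (hr.step s) (by omega))
      rwa [step_step] at this

/-! ### Quotients of the honeycomb lattice: inducing and lifting automorphisms. -/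

/-- `G` is the quotient of the honeycomb lattice by the group `Λ` of translations. -/
structure HoneycombCover {V : Type*} (G : SimpleGraph V) (Λ : AddSubgroup (Fin 3 → ℤ)) where
  /-- the covering map -/
  proj : (Fin 3 → ℤ) → V
  sum_eq_zero : ∀ v ∈ Λ, v 0 + v 1 + v 2 = 0
  surj : ∀ u, ∃ p, IsVertex p ∧ proj p = u
  eq_iff : ∀ p q, IsVertex p → IsVertex q → (proj p = proj q ↔ p - q ∈ Λ)
  adj_iff : ∀ p u, IsVertex p → (G.Adj (proj p) u ↔ ∃ s, u = proj (step s p))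
  single_sub_single_notMem : ∀ s t, s ≠ t → (Pi.single s 1 - Pi.single t 1 : Fin 3 → ℤ) ∉ Λ

/-- The permutation `σ` of the coordinates preserves `Λ`. -/
def PreservedBy (Λ : AddSubgroup (Fin 3 → ℤ)) (σ : Equiv.Perm (Fin 3)) : Prop :=
  ∀ v : Fin 3 → ℤ, (fun i => v (σ i)) ∈ Λ ↔ v ∈ Λ

lemma PreservedBy.symm {Λ : AddSubgroup (Fin 3 → ℤ)} {σ : Equiv.Perm (Fin 3)}
    (h : PreservedBy Λ σ) : PreservedBy Λ σ.symm := by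
  intro v
  rw [← h]; simp

lemma mul_vsign_mem_iff {Λ : AddSubgroup (Fin 3 → ℤ)} {x : ℤ} (hx : x = 1 ∨ x = -1)
    (v : Fin 3 → ℤ) : (fun i => x * v i) ∈ Λ ↔ v ∈ Λ := by
  rcases hx with rfl | rfl
  · simp
  · rw [← neg_mem_iff]
    congr! 1
    funext i; simp

/-- The number of ways to continue, by `j` further steps, a non-backtracking walk in the honeycomb
lattice which has arrived at displacement `(a, b, c)` along an edge of colour `s`, to a closed
non-backtracking walk in the quotient that begins with an edge of colour `c₁`. The predicate `P`
tells which displacements are closed; `x` is the sign of the next step. -/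
def closures (P : ℤ → ℤ → ℤ → Bool) (c₁ : Fin 3) : ℕ → ℤ → ℤ → ℤ → ℤ → Fin 3 → ℕ
  | 0, _, a, b, c, s => if s = c₁ then 0 else if P a b c then 1 else 0
  | j + 1, x, a, b, c, s =>
    (if 0 = s then 0 else closures P c₁ j (-x) (a + x) b c 0) +
    (if 1 = s then 0 else closures P c₁ j (-x) a (b + x) c 1) +
    (if 2 = s then 0 else closures P c₁ j (-x) a b (c + x) 2)

/-- The number of closed non-backtracking walks of length `j + 3` that begin with edges of
colours `t`, `s`, `r`. -/
def pathCount (P : ℤ → ℤ → ℤ → Bool) (j : ℕ) (t s r : Fin 3) : ℕ :=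
  closures P t j (-1)
    ((if t = 0 then 1 else 0) - (if s = 0 then 1 else 0) + (if r = 0 then 1 else 0))
    ((if t = 1 then 1 else 0) - (if s = 1 then 1 else 0) + (if r = 1 then 1 else 0))
    ((if t = 2 then 1 else 0) - (if s = 2 then 1 else 0) + (if r = 2 then 1 else 0)) r

/-- The numbers of closed walks of length `j + 3` through the `3`-arcs of the quotient show that an
automorphism permutes the colours at adjacent vertices in the same way. -/
def LocallyRigid (P : ℤ → ℤ → ℤ → Bool) (j : ℕ) : Prop :=
  ∀ s t r : Fin 3, t ≠ s ∧ r ≠ s ∧ t ≠ r → ∀ s' t' r' : Fin 3, t' ≠ s' ∧ r' ≠ s' ∧ t' ≠ r' →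
    ¬ (pathCount P j t s r = pathCount P j t' s' t' ∧ pathCount P j r s t = pathCount P j r' s' r' ∧
      pathCount P j t s t = pathCount P j t' s' r' ∧ pathCount P j r s r = pathCount P j r' s' t')

instance (P : ℤ → ℤ → ℤ → Bool) (j : ℕ) : Decidable (LocallyRigid P j) := by
  unfold LocallyRigid; infer_instance

namespace HoneycombCover

variable {V : Type*} {G : SimpleGraph V} {Λ : AddSubgroup (Fin 3 → ℤ)} (C : HoneycombCover G Λ)

lemma sub_single_mem_iff {s t : Fin 3} {x : ℤ} (hx : x = 1 ∨ x = -1) :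
    (Pi.single s x - Pi.single t x : Fin 3 → ℤ) ∈ Λ ↔
      (Pi.single s 1 - Pi.single t 1 : Fin 3 → ℤ) ∈ Λ := by
  rcases hx with rfl | rfl
  · rfl
  · rw [← neg_mem_iff, Pi.single_neg, Pi.single_neg]
    congr! 1
    abel

lemma proj_step_inj {p : Fin 3 → ℤ} (hp : IsVertex p) {s t : Fin 3} :
    C.proj (step s p) = C.proj (step t p) ↔ s = t := by
  refine ⟨fun h => ?_, fun h => by rw [h]⟩
  by_contra hne
  rw [C.eq_iff _ _ (hp.step s) (hp.step t), step, step, add_sub_add_left_eq_sub,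
    sub_single_mem_iff hp.vsign_eq] at h
  exact C.single_sub_single_notMem s t hne h

include C in
lemma vsign_eq_of_sub_mem {p q : Fin 3 → ℤ} (h : p - q ∈ Λ) : vsign p = vsign q := by
  have := C.sum_eq_zero _ h
  simp only [Pi.sub_apply] at this
  unfold vsign
  linarith

lemma proj_step_eq {p q : Fin 3 → ℤ} (hp : IsVertex p) (hq : IsVertex q)
    (h : C.proj p = C.proj q) (s : Fin 3) : C.proj (step s p) = C.proj (step s q) := by
  rw [C.eq_iff _ _ hp hq] at h
  rw [C.eq_iff _ _ (hp.step s) (hq.step s), step, step, C.vsign_eq_of_sub_mem h]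
  simpa using h

/-- The difference of the two images is, up to sign, the permuted difference of the two points. This
is what lets an affine symmetry descend to the quotient. -/
lemma proj_affine_eq_iff {σ : Equiv.Perm (Fin 3)} (hσ : PreservedBy Λ σ) {p q r r' : Fin 3 → ℤ}
    (hp : IsVertex p) (hq : IsVertex q) (hr : IsVertex r) (hr' : IsVertex r') :
    C.proj (affine σ p q r) = C.proj (affine σ p q r') ↔ C.proj r = C.proj r' := by
  have hx : vsign p * vsign q = 1 ∨ vsign p * vsign q = -1 := by
    rcases hp.vsign_eq with h1 | h1 <;> rcases hq.vsign_eq with h2 | h2 <;> simp [h1, h2]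
  have e : affine σ p q r - affine σ p q r' =
      fun i => vsign p * vsign q * (fun i => (r - r') (σ.symm i)) i := by
    funext i
    simp only [affine, Pi.sub_apply]
    ring
  rw [C.eq_iff _ _ (isVertex_affine σ hp hq hr) (isVertex_affine σ hp hq hr'),
    C.eq_iff _ _ hr hr', e, mul_vsign_mem_iff hx, hσ.symm (r - r')]

/-- A symmetry of the honeycomb lattice that preserves `Λ` induces an automorphism. -/
theorem exists_iso {σ : Equiv.Perm (Fin 3)} (hσ : PreservedBy Λ σ) {p q : Fin 3 → ℤ}
    (hp : IsVertex p) (hq : IsVertex q) :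
    ∃ φ : G ≃g G, ∀ r, IsVertex r → φ (C.proj r) = C.proj (affine σ p q r) := by
  choose L hL hLp using C.surj
  have key : ∀ (σ : Equiv.Perm (Fin 3)) (p q r : Fin 3 → ℤ), PreservedBy Λ σ → IsVertex p →
      IsVertex q → IsVertex r →
      C.proj (affine σ p q (L (C.proj r))) = C.proj (affine σ p q r) := by
    intro σ p q r hσ hp hq hr
    rw [C.proj_affine_eq_iff hσ hp hq (hL _) hr, hLp]
  refine ⟨⟨⟨fun u => C.proj (affine σ p q (L u)), fun u => C.proj (affine σ.symm q p (L u)),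
    ?_, ?_⟩, ?_⟩, fun r hr => key σ p q r hσ hp hq hr⟩
  · intro u
    change C.proj (affine σ.symm q p (L (C.proj (affine σ p q (L u))))) = u
    rw [key _ _ _ _ hσ.symm hq hp (isVertex_affine σ hp hq (hL u)), affine_affine σ _ hp hq, hLp]
  · intro u
    have h := affine_affine σ.symm (L u) hq hp
    rw [Equiv.symm_symm] at h
    change C.proj (affine σ p q (L (C.proj (affine σ.symm q p (L u))))) = u
    rw [key _ _ _ _ hσ hp hq (isVertex_affine σ.symm hq hp (hL u)), h, hLp]
  · intro u v
    simp only [Equiv.coe_fn_mk]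
    rw [C.adj_iff _ _ (isVertex_affine σ hp hq (hL u))]
    conv_rhs => rw [← hLp u, C.adj_iff _ _ (hL u), ← hLp v]
    constructor
    · rintro ⟨s, hs⟩
      refine ⟨σ.symm s, ?_⟩
      rwa [← C.proj_affine_eq_iff hσ hp hq (hL v) ((hL u).step _), affine_step σ hp hq,
        Equiv.apply_symm_apply]
    · rintro ⟨s, hs⟩
      refine ⟨σ s, ?_⟩
      rwa [← affine_step σ hp hq, C.proj_affine_eq_iff hσ hp hq (hL v) ((hL u).step _)]

/-- The permutation of the colours induced at a vertex by an automorphism. -/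
lemma exists_local_perm (φ : G ≃g G) {p q : Fin 3 → ℤ} (hp : IsVertex p) (hq : IsVertex q)
    (h : φ (C.proj p) = C.proj q) :
    ∃ σ : Equiv.Perm (Fin 3), ∀ s, φ (C.proj (step s p)) = C.proj (step (σ s) q) := by
  have H : ∀ s, ∃ t, φ (C.proj (step s p)) = C.proj (step t q) := by
    intro s
    rw [← C.adj_iff _ _ hq, ← h, φ.map_adj_iff, C.adj_iff _ _ hp]
    exact ⟨s, rfl⟩
  choose f hf using H
  have hinj : Function.Injective f := by
    intro s t hst
    rw [← C.proj_step_inj hp]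
    apply φ.injective
    rw [hf, hf, hst]
  exact ⟨Equiv.ofBijective f (Finite.injective_iff_bijective.1 hinj), hf⟩

open Classical in
/-- The number of non-backtracking walks of length `j` that start at `p`, just reached along an edge
of colour `s`, and end at `p₀`, to be continued along an edge of colour `c₁`. -/
noncomputable def walkCount (p₀ : Fin 3 → ℤ) (c₁ : Fin 3) : ℕ → (Fin 3 → ℤ) → Fin 3 → ℕ
  | 0, p, s => if s = c₁ then 0 else if C.proj p = C.proj p₀ then 1 else 0
  | j + 1, p, s => ∑ s', if s' = s then 0 else walkCount p₀ c₁ j (step s' p) s'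

/-- Colours are not preserved by `φ`, but non-backtracking and closing up are properties of the
graph; at each vertex the sum over the next colour is reindexed by the local permutation. -/
lemma walkCount_map (φ : G ≃g G) {p₀ q₀ : Fin 3 → ℤ} (hp₀ : IsVertex p₀) (hq₀ : IsVertex q₀)
    {c₁ d₁ : Fin 3} (h₀ : φ (C.proj p₀) = C.proj q₀)
    (h₁ : φ (C.proj (step c₁ p₀)) = C.proj (step d₁ q₀)) (j : ℕ) :
    ∀ (p q : Fin 3 → ℤ) (s t : Fin 3), IsVertex p → IsVertex q → φ (C.proj p) = C.proj q →
      φ (C.proj (step s p)) = C.proj (step t q) →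
      C.walkCount p₀ c₁ j p s = C.walkCount q₀ d₁ j q t := by
  induction j with
  | zero =>
    intro p q s t hp hq h hs
    have e : C.proj p = C.proj p₀ ↔ C.proj q = C.proj q₀ := by
      rw [← h, ← h₀, φ.injective.eq_iff]
    simp only [walkCount]
    by_cases h2 : C.proj q = C.proj q₀
    · have h1 := e.2 h2
      -- When the walk closes, both colours label edges at the same vertex of the quotient, so equal
      -- colours mean equal neighbours, and `φ` respects that.
      have : s = c₁ ↔ t = d₁ := by
        rw [← C.proj_step_inj hp, ← C.proj_step_inj hq, C.proj_step_eq hp hp₀ h1 c₁,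
          C.proj_step_eq hq hq₀ h2 d₁, ← hs, ← h₁, φ.injective.eq_iff]
      simp only [this, if_pos h1, if_pos h2]
    · rw [if_neg h2, if_neg (mt e.1 h2), ite_self, ite_self]
  | succ j ih =>
    intro p q s t hp hq h hs
    obtain ⟨σ, hσ⟩ := C.exists_local_perm φ hp hq h
    have hst : σ s = t := by rw [← C.proj_step_inj hq, ← hσ, hs]
    simp only [walkCount]
    rw [← Equiv.sum_comp σ (fun s' => if s' = t then 0 else C.walkCount q₀ d₁ j (step s' q) s')]
    refine Finset.sum_congr rfl fun s' _ => ?_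
    simp only [← hst, σ.injective.eq_iff]
    congr 1
    refine ih _ _ _ _ (hp.step _) (hq.step _) (hσ s') ?_
    rw [step_step, step_step, h]

/-- Multiplying displacements by `vsign p₀` makes every walk start with sign +1; since Λ is closed
under negation, the count depends only on colours and displacement and becomes computable. -/
lemma walkCount_eq_closures {P : ℤ → ℤ → ℤ → Bool} (hP : ∀ v : Fin 3 → ℤ,
    P (v 0) (v 1) (v 2) = true ↔ v ∈ Λ) {p₀ : Fin 3 → ℤ} (hp₀ : IsVertex p₀) (c₁ : Fin 3) (j : ℕ) :
    ∀ (p : Fin 3 → ℤ) (s : Fin 3), IsVertex p → C.walkCount p₀ c₁ j p s =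
      closures P c₁ j (vsign p₀ * vsign p) (vsign p₀ * (p 0 - p₀ 0)) (vsign p₀ * (p 1 - p₀ 1))
        (vsign p₀ * (p 2 - p₀ 2)) s := by
  induction j with
  | zero =>
    intro p s hp
    have h1 := hP (fun i => vsign p₀ * (p i - p₀ i))
    have h2 := mul_vsign_mem_iff (Λ := Λ) hp₀.vsign_eq (p - p₀)
    simp only [Pi.sub_apply] at h2
    simp only [walkCount, closures]
    rw [h2, ← C.eq_iff _ _ hp hp₀] at h1
    split_ifs <;> tauto
  | succ j ih =>
    intro p s hp
    simp only [walkCount, closures, Fin.sum_univ_three]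
    have e : ∀ (s' : Fin 3), C.walkCount p₀ c₁ j (step s' p) s' = _ :=
      fun s' => ih (step s' p) s' (hp.step s')
    rw [e 0, e 1, e 2]
    have f0 : ∀ x y z : ℤ, x * (y + z - p₀ 0) = x * (y - p₀ 0) + x * z := fun _ _ _ => by ring
    have f1 : ∀ x y z : ℤ, x * (y + z - p₀ 1) = x * (y - p₀ 1) + x * z := fun _ _ _ => by ring
    have f2 : ∀ x y z : ℤ, x * (y + z - p₀ 2) = x * (y - p₀ 2) + x * z := fun _ _ _ => by ring
    simp only [vsign_step, mul_neg]
    simp [step, f0, f1, f2]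

/-- The number of closed walks through a `3`-arc. -/
lemma walkCount_eq_pathCount {P : ℤ → ℤ → ℤ → Bool} (hP : ∀ v : Fin 3 → ℤ,
    P (v 0) (v 1) (v 2) = true ↔ v ∈ Λ) {p : Fin 3 → ℤ} (hp : IsVertex p) (j : ℕ) (t s r : Fin 3) :
    C.walkCount (step t p) t j (step r (step s p)) r = pathCount P j t s r := by
  rw [C.walkCount_eq_closures hP (hp.step t) t j _ r ((hp.step s).step r)]
  have h := hp.vsign_mul_self
  have key : ∀ i : Fin 3, vsign (step t p) * (step r (step s p) i - step t p i) =
      (if t = i then 1 else 0) - (if s = i then 1 else 0) + (if r = i then 1 else 0) := by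
    intro i
    rw [vsign_step, step.eq_def r, vsign_step, step.eq_def s, step.eq_def t]
    simp only [Pi.add_apply, Pi.single_apply, eq_comm (a := i)]
    split_ifs <;> first | ring1 | linear_combination h | linear_combination -h |
      linear_combination 2 * h
  rw [key, key, key, pathCount, vsign_step, vsign_step, vsign_step, neg_neg, neg_mul, h]

/-- The two local permutations agree on the colour of the common edge, so if they differ, they
differ by exchanging the images of the other two colours. Then 3-arcs coloured t, s, r with distinct
colours are exchanged with those coloured t, s, t, and the walk counts contradict `LocallyRigid`. -/
lemma local_perm_eq {P : ℤ → ℤ → ℤ → Bool} (hP : ∀ v : Fin 3 → ℤ,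
    P (v 0) (v 1) (v 2) = true ↔ v ∈ Λ) {j : ℕ} (hR : LocallyRigid P j) (φ : G ≃g G)
    {p q : Fin 3 → ℤ} (hp : IsVertex p) (hq : IsVertex q) (h : φ (C.proj p) = C.proj q)
    {σ τ : Equiv.Perm (Fin 3)} (hσ : ∀ s, φ (C.proj (step s p)) = C.proj (step (σ s) q))
    {s : Fin 3}
    (hτ : ∀ t, φ (C.proj (step t (step s p))) = C.proj (step (τ t) (step (σ s) q))) : τ = σ := by
  have hs : τ s = σ s := by
    have := hτ s
    rw [step_step, h] at this
    rw [← C.proj_step_inj (hq.step (σ s)), ← this, step_step]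
  have count : ∀ t r, pathCount P j t s r = pathCount P j (σ t) (σ s) (τ r) := by
    intro t r
    rw [← C.walkCount_eq_pathCount hP hp, ← C.walkCount_eq_pathCount hP hq]
    apply C.walkCount_map φ (hp.step _) (hq.step _) (hσ t)
    · rw [step_step, step_step, h]
    · exact (hp.step s).step r
    · exact (hq.step _).step _
    · exact hτ r
    · rw [step_step, step_step, hσ]
  obtain ⟨t, r, hts, hrs, htr, hall⟩ : ∃ t r : Fin 3, t ≠ s ∧ r ≠ s ∧ t ≠ r ∧
      ∀ x, x = s ∨ x = t ∨ x = r :=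
    (by decide : ∀ s : Fin 3, ∃ t r : Fin 3, t ≠ s ∧ r ≠ s ∧ t ≠ r ∧
      ∀ x, x = s ∨ x = t ∨ x = r) s
  by_cases hst : τ t = σ t
  · have hr : τ r = σ r := by
      have h1 := τ.injective.ne hrs
      have h2 := τ.injective.ne htr
      have h3 := σ.injective.ne hrs
      have h4 := σ.injective.ne htr
      rw [hs] at h1
      rw [hst] at h2
      have h5 := σ.injective.ne hts
      omega
    ext x
    rcases hall x with rfl | rfl | rfl <;> simp [*]
  · exfalso
    have h1 := τ.injective.ne hrs
    have h2 := τ.injective.ne htr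
    have h3 := σ.injective.ne hrs
    have h4 := σ.injective.ne htr
    have h5 := σ.injective.ne hts
    have h6 := τ.injective.ne hts
    rw [hs] at h1 h6
    have e1 : τ t = σ r := by omega
    have e2 : τ r = σ t := by omega
    refine hR s t r ⟨hts, hrs, htr⟩ (σ s) (σ t) (σ r) ⟨h5, h3, h4⟩ ⟨?_, ?_, ?_, ?_⟩
    · rw [count t r, e2]
    · rw [count r t, e1]
    · rw [count t t, e1]
    · rw [count r r, e2]

/-- If the quotient is locally rigid, then all its automorphisms are induced by symmetries of the
honeycomb lattice. -/
theorem eq_affine {P : ℤ → ℤ → ℤ → Bool} (hP : ∀ v : Fin 3 → ℤ,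
    P (v 0) (v 1) (v 2) = true ↔ v ∈ Λ) {j : ℕ} (hR : LocallyRigid P j) (φ : G ≃g G)
    {p q : Fin 3 → ℤ} (hp : IsVertex p) (hq : IsVertex q) (h : φ (C.proj p) = C.proj q) :
    ∃ σ, PreservedBy Λ σ ∧ ∀ r, IsVertex r → φ (C.proj r) = C.proj (affine σ p q r) := by
  obtain ⟨σ, hσ⟩ := C.exists_local_perm φ hp hq h
  have H : ∀ r, IsVertex r → φ (C.proj r) = C.proj (affine σ p q r) ∧
      ∀ s, φ (C.proj (step s r)) = C.proj (step (σ s) (affine σ p q r)) := by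
    refine isVertex_induction (Q := fun r => φ (C.proj r) = C.proj (affine σ p q r) ∧
      ∀ s, φ (C.proj (step s r)) = C.proj (step (σ s) (affine σ p q r))) hp ?_ ?_
    · rw [affine_self]; exact ⟨h, hσ⟩
    · rintro r s hr ⟨h1, h2⟩
      have h3 : φ (C.proj (step s r)) = C.proj (affine σ p q (step s r)) := by
        rw [affine_step σ hp hq]; exact h2 s
      refine ⟨h3, ?_⟩
      obtain ⟨τ, hτ⟩ := C.exists_local_perm φ (hr.step s)
        (isVertex_affine σ hp hq (hr.step s)) h3
      have : τ = σ := by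
        refine C.local_perm_eq hP hR φ hr (isVertex_affine σ hp hq hr) h1 h2 (s := s) ?_
        rw [← affine_step σ hp hq]; exact hτ
      rwa [this] at hτ
  refine ⟨σ, fun v => ?_, fun r hr => (H r hr).1⟩
  -- Outside the sum-zero plane neither vector is in Λ. Inside it, `p + w` is again a vertex, and `w
  -- ∈ Λ` says that it projects to the same point as `p`; applying `φ` turns this into the same
  -- statement about `q` and `± v`.
  wlog hv : v 0 + v 1 + v 2 = 0
  · constructor
    · intro h'
      have := C.sum_eq_zero _ h'
      rw [sum_perm σ v] at this
      exact absurd this hv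
    · intro h'
      exact absurd (C.sum_eq_zero _ h') hv
  set w : Fin 3 → ℤ := fun i => v (σ i) with hw
  have hpw : IsVertex (p + w) := by
    have := sum_perm σ v
    unfold IsVertex at *
    simp only [Pi.add_apply, hw]
    omega
  have e1 : w ∈ Λ ↔ C.proj (p + w) = C.proj p := by
    rw [C.eq_iff _ _ hpw hp]; simp
  have hx : vsign p * vsign q = 1 ∨ vsign p * vsign q = -1 := by
    rcases hp.vsign_eq with h1 | h1 <;> rcases hq.vsign_eq with h2 | h2 <;> simp [h1, h2]
  rw [e1, ← φ.injective.eq_iff, (H _ hpw).1, h,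
    C.eq_iff _ _ (isVertex_affine σ hp hq hpw) hq, ← mul_vsign_mem_iff hx v]
  congr! 1
  funext i
  simp [affine, hw]

end HoneycombCover

/-! ### Honeycomb toroidal graphs as quotients of the honeycomb lattice. -/

/-- The translations of the honeycomb lattice whose quotient is `HTG m n l`. -/
def htgLattice (m n l : ℕ) : AddSubgroup (Fin 3 → ℤ) where
  carrier := {v | v 0 + v 1 + v 2 = 0 ∧ ∃ k : ℤ, v 2 = -(m * k) ∧ (n : ℤ) ∣ v 0 - v 1 + l * k}
  zero_mem' := ⟨by simp, 0, by simp⟩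
  add_mem' := by
    rintro v w ⟨hv, k, hk, hk'⟩ ⟨hw, k', hk2, hk2'⟩
    refine ⟨?_, k + k', ?_, ?_⟩
    · simp only [Pi.add_apply]; linarith
    · simp only [Pi.add_apply, hk, hk2]; ring
    · obtain ⟨a, ha⟩ := hk'
      obtain ⟨b, hb⟩ := hk2'
      exact ⟨a + b, by simp only [Pi.add_apply]; linear_combination ha + hb⟩
  neg_mem' := by
    rintro v ⟨hv, k, hk, hk'⟩
    refine ⟨?_, -k, ?_, ?_⟩
    · simp only [Pi.neg_apply]; linarith
    · simp only [Pi.neg_apply, hk]; ring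
    · obtain ⟨a, ha⟩ := hk'
      exact ⟨-a, by simp only [Pi.neg_apply]; linear_combination -ha⟩

lemma mem_htgLattice {m n l : ℕ} {v : Fin 3 → ℤ} : v ∈ htgLattice m n l ↔
    v 0 + v 1 + v 2 = 0 ∧ ∃ k : ℤ, v 2 = -(m * k) ∧ (n : ℤ) ∣ v 0 - v 1 + l * k := Iff.rfl

/-- The projection of the honeycomb lattice onto `HTG m n l`. -/
def htgProj (m n l : ℕ) (p : Fin 3 → ℤ) : ZMod m × ZMod n :=
  (((-p 2 : ℤ) : ZMod m), ((p 0 - p 1 + l * (-p 2 / m) : ℤ) : ZMod n))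

section Projection

variable {m n l : ℕ}

/-- The row is `-p 2` and the column `p 0 - p 1`; the quotient `-p 2 / m` counts passages from the
last row to row 0, each of which shifts the column by `l`. Equal projections force equal coordinate
sums, since n is even and l, m have the same parity, so the sums, being 0 or 1, agree mod 2. -/
lemma htgProj_eq_iff (hm : 1 ≤ m) (hn_even : Even n) (hparity : l % 2 = m % 2)
    {p q : Fin 3 → ℤ} (hp : IsVertex p) (hq : IsVertex q) :
    htgProj m n l p = htgProj m n l q ↔ p - q ∈ htgLattice m n l := by
  have hm0 : (m : ℤ) ≠ 0 := by omega
  rw [htgProj, htgProj, Prod.mk.injEq, ZMod.intCast_eq_intCast_iff_dvd_sub,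
    ZMod.intCast_eq_intCast_iff_dvd_sub, mem_htgLattice]
  simp only [Pi.sub_apply]
  constructor
  · rintro ⟨⟨k, hk⟩, h2⟩
    have e : -p 2 = -q 2 + m * (-k) := by linarith
    rw [e, Int.add_mul_ediv_left _ _ hm0] at h2
    have h3 : (n : ℤ) ∣ p 0 - q 0 - (p 1 - q 1) + l * (-k) := by
      obtain ⟨a, ha⟩ := h2
      exact ⟨-a, by linear_combination -ha⟩
    refine ⟨?_, -k, by linarith, h3⟩
    obtain ⟨n', hn'⟩ := hn_even
    have h4 : (2 : ℤ) ∣ p 0 - q 0 - (p 1 - q 1) + l * (-k) :=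
      dvd_trans ⟨n', by push_cast [hn']; ring⟩ h3
    have h5 : (2 : ℤ) ∣ (l - m) * k := Dvd.dvd.mul_right (by omega) k
    have e1 : ((l : ℤ) - m) * k = l * k - m * k := by ring
    have e2 : (l : ℤ) * (-k) = -(l * k) := by ring
    unfold IsVertex at hp hq
    rw [e1] at h5
    rw [e2] at h4
    omega
  · rintro ⟨h0, k, hk, h⟩
    refine ⟨⟨-k, by linarith⟩, ?_⟩
    have e : -p 2 = -q 2 + m * k := by linarith
    rw [e, Int.add_mul_ediv_left _ _ hm0]
    obtain ⟨a, ha⟩ := h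
    exact ⟨-a, by linear_combination -ha⟩

lemma htgProj_surj (hm : 1 ≤ m) (hn : 4 ≤ n) (u : ZMod m × ZMod n) :
    ∃ p, IsVertex p ∧ htgProj m n l p = u := by
  have : NeZero m := ⟨by omega⟩
  have : NeZero n := ⟨by omega⟩
  obtain ⟨i, j⟩ := u
  have hi : (i.val : ℤ) / m = 0 := Int.ediv_eq_zero_of_lt (by omega) (by have := i.val_lt; omega)
  -- The conditions `p 2 = -i` and `p 0 - p 1 = j` give coordinate sum `2 * p 0 - i - j`; rounding
  -- (i + j)/2 up makes this 0 or 1.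
  refine ⟨![((i.val : ℤ) + j.val + 1) / 2, ((i.val : ℤ) + j.val + 1) / 2 - j.val, -i.val], ?_, ?_⟩
  · simp [IsVertex]; omega
  · have e : -(![((i.val : ℤ) + j.val + 1) / 2, ((i.val : ℤ) + j.val + 1) / 2 - j.val,
        -(i.val : ℤ)] : Fin 3 → ℤ) 2 = i.val := by simp
    rw [htgProj, e, hi]
    simp

lemma htgProj_step_eq (hm : 1 ≤ m) (hn_even : Even n) (hparity : l % 2 = m % 2)
    {p q : Fin 3 → ℤ} (hp : IsVertex p) (hq : IsVertex q)
    (h : htgProj m n l p = htgProj m n l q) (s : Fin 3) :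
    htgProj m n l (step s p) = htgProj m n l (step s q) := by
  rw [htgProj_eq_iff hm hn_even hparity hp hq] at h
  have hs : vsign p = vsign q := by
    have := (mem_htgLattice.1 h).1
    simp only [Pi.sub_apply] at this
    unfold vsign; linarith
  rw [htgProj_eq_iff hm hn_even hparity (hp.step s) (hq.step s), step, step, hs]
  simpa using h

/-- The relation that generates the adjacency of `HTG m n l`, in the coordinates of the honeycomb
lattice. -/
lemma htg_rel_iff (hm : 1 ≤ m) (hn : 4 ≤ n) (hn_even : Even n) (hparity : l % 2 = m % 2)
    {p : Fin 3 → ℤ} (hp : IsVertex p) (v : ZMod m × ZMod n) :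
    ((v.1 = (htgProj m n l p).1 ∧ v.2 = (htgProj m n l p).2 + 1) ∨
      ((htgProj m n l p).1.val ≠ m - 1 ∧
        (htgProj m n l p).1.val % 2 ≠ (htgProj m n l p).2.val % 2 ∧
        v.1 = (htgProj m n l p).1 + 1 ∧ v.2 = (htgProj m n l p).2) ∨
      ((htgProj m n l p).1.val = m - 1 ∧ (htgProj m n l p).2.val % 2 = m % 2 ∧ v.1 = 0 ∧
        v.2 = (htgProj m n l p).2 + (l : ZMod n))) ↔
    v = htgProj m n l (step (if vsign p = 1 then 0 else 1) p) ∨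
      (vsign p = -1 ∧ v = htgProj m n l (step 2 p)) := by
  have : NeZero m := ⟨by omega⟩
  have : NeZero n := ⟨by omega⟩
  have hm0 : (m : ℤ) ≠ 0 := by omega
  set k : ℤ := -p 2 / m with hk
  set i : ℤ := -p 2 % m with hi
  have hik : m * k + i = -p 2 := Int.mul_ediv_add_emod _ _
  have hi0 : 0 ≤ i := Int.emod_nonneg _ hm0
  have him : i < m := Int.emod_lt_of_pos _ (by omega)
  have hv1 : ((htgProj m n l p).1.val : ℤ) = i := by
    rw [htgProj, ZMod.val_intCast]
  have hv2 : ((htgProj m n l p).2.val : ℤ) = (p 0 - p 1 + l * k) % n := by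
    rw [htgProj, ZMod.val_intCast]
  -- Row and column together determine the coordinate sum mod 2, which turns the parity conditions
  -- of `HTG` into conditions on `vsign p`.
  have hv2' : ((htgProj m n l p).2.val : ℤ) % 2 = (p 0 + p 1 + p 2 + i) % 2 := by
    obtain ⟨n', hn'⟩ := hn_even
    rw [hv2, Int.emod_emod_of_dvd _ ⟨n', by push_cast [hn']; ring⟩]
    have h5 : (2 : ℤ) ∣ (l - m) * k := Dvd.dvd.mul_right (by omega) k
    have e1 : ((l : ℤ) - m) * k = l * k - m * k := by ring
    rw [e1] at h5
    omega
  have step1 : (v.1 = (htgProj m n l p).1 ∧ v.2 = (htgProj m n l p).2 + 1) ↔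
      v = htgProj m n l (step (if vsign p = 1 then 0 else 1) p) := by
    rw [Prod.ext_iff]
    rcases hp.vsign_eq with h | h
    · rw [if_pos h]
      simp only [htgProj, step, h]
      simp
      intro _
      congr! 1; ring
    · rw [if_neg (by rw [h]; norm_num)]
      simp only [htgProj, step, h]
      simp
      intro _
      congr! 1; ring
  rw [step1]
  refine or_congr Iff.rfl ?_
  have hs : vsign p = -1 ↔ p 0 + p 1 + p 2 = 1 := by unfold vsign; omega
  by_cases hlast : i = m - 1
  · have e1 : (htgProj m n l p).1.val = m - 1 := by omega
    have e2 : (-p 2 + 1) / m = k + 1 := by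
      rw [← hik, show (m : ℤ) * k + i + 1 = m * (k + 1) by rw [hlast]; ring,
        Int.mul_ediv_cancel_left _ hm0]
    have e3 : ((htgProj m n l p).2.val % 2 = m % 2) ↔ vsign p = -1 := by
      rw [hs]
      unfold IsVertex at hp
      omega
    have e4 : vsign p = -1 → (v = htgProj m n l (step 2 p) ↔
        v.1 = 0 ∧ v.2 = (htgProj m n l p).2 + (l : ZMod n)) := by
      intro h
      have e5 : ((-p 2 + 1 : ℤ) : ZMod m) = 0 := by
        rw [ZMod.intCast_zmod_eq_zero_iff_dvd]
        exact ⟨k + 1, by rw [← hik, hlast]; ring⟩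
      have e6 : -(p 2 + -1) = -p 2 + 1 := by ring
      rw [Prod.ext_iff]
      simp only [htgProj, step, h, Pi.add_apply, Pi.single_eq_same, e6, e5, e2]
      simp
      intro _
      rw [← hk]
      congr! 1; ring
    simp only [e1, ne_eq, not_true_eq_false, false_and, false_or, true_and, e3]
    constructor
    · rintro ⟨h, h'⟩; exact ⟨h, (e4 h).2 h'⟩
    · rintro ⟨h, h'⟩; exact ⟨h, (e4 h).1 h'⟩
  · have e1 : (htgProj m n l p).1.val ≠ m - 1 := by omega
    have e2 : (-p 2 + 1) / m = k := by
      rw [← hik, add_assoc, Int.mul_add_ediv_left _ _ hm0,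
        Int.ediv_eq_zero_of_lt (by omega) (by omega), add_zero]
    have e3 : ((htgProj m n l p).1.val % 2 ≠ (htgProj m n l p).2.val % 2) ↔ vsign p = -1 := by
      rw [hs]
      unfold IsVertex at hp
      omega
    have e4 : vsign p = -1 → (v = htgProj m n l (step 2 p) ↔
        v.1 = (htgProj m n l p).1 + 1 ∧ v.2 = (htgProj m n l p).2) := by
      intro h
      have e6 : -(p 2 + -1) = -p 2 + 1 := by ring
      rw [Prod.ext_iff]
      simp only [htgProj, step, h, Pi.add_apply, Pi.single_eq_same, e6, e2]
      simp [hk]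
    simp only [e1, ne_eq, not_false_eq_true, false_and, or_false, true_and]
    rw [← ne_eq, e3]
    constructor
    · rintro ⟨h, h'⟩; exact ⟨h, (e4 h).2 h'⟩
    · rintro ⟨h, h'⟩; exact ⟨h, (e4 h).1 h'⟩

/-- The generating relation read from a sum-0 vertex yields colour 0, and from a sum-1 vertex
colours 1 and 2. Neighbours have opposite signs and steps are involutions, so reading it from the
other end supplies the missing colours. -/
lemma htg_adj_iff (hm : 1 ≤ m) (hn : 4 ≤ n) (hn_even : Even n) (hparity : l % 2 = m % 2)
    {p : Fin 3 → ℤ} (hp : IsVertex p) (u : ZMod m × ZMod n) :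
    (HTG m n l).Adj (htgProj m n l p) u ↔ ∃ s, u = htgProj m n l (step s p) := by
  obtain ⟨q, hq, rfl⟩ := htgProj_surj (l := l) hm hn u
  have back : ∀ s, htgProj m n l p = htgProj m n l (step s q) →
      htgProj m n l q = htgProj m n l (step s p) := by
    intro s h
    rw [htgProj_step_eq hm hn_even hparity hp (hq.step s) h, step_step]
  have back' : ∀ s, htgProj m n l q = htgProj m n l (step s p) →
      htgProj m n l p = htgProj m n l (step s q) := by
    intro s h
    rw [htgProj_step_eq hm hn_even hparity hq (hp.step s) h, step_step]
  rw [HTG, SimpleGraph.fromRel_adj, htg_rel_iff hm hn hn_even hparity hp,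
    htg_rel_iff hm hn hn_even hparity hq]
  constructor
  · rintro ⟨-, (h | ⟨-, h⟩) | (h | ⟨-, h⟩)⟩
    · exact ⟨_, h⟩
    · exact ⟨_, h⟩
    · exact ⟨_, back _ h⟩
    · exact ⟨_, back _ h⟩
  · rintro ⟨s, hs⟩
    have hsum := sum_step s p
    have h2 : vsign q = -vsign p := by
      rw [htgProj_eq_iff hm hn_even hparity hq (hp.step s)] at hs
      have := (mem_htgLattice.1 hs).1
      simp only [Pi.sub_apply] at this
      rw [← vsign_step s p]
      unfold vsign; linarith
    refine ⟨fun h => ?_, ?_⟩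
    · rw [htgProj_eq_iff hm hn_even hparity hp hq] at h
      have := (mem_htgLattice.1 h).1
      simp only [Pi.sub_apply] at this
      unfold vsign at h2
      omega
    · have h3 := back' s hs
      rcases hp.vsign_eq with h | h <;> rw [h] at h2 ⊢ <;> simp only [h2] <;>
        fin_cases s <;> simp_all

end Projection

/-- `HTG m n l` as a quotient of the honeycomb lattice. -/
def htgCover {m n l : ℕ} (hm : 1 ≤ m) (hn : 4 ≤ n) (hn_even : Even n) (hparity : l % 2 = m % 2)
    (h : ∀ s t : Fin 3, s ≠ t → (Pi.single s 1 - Pi.single t 1 : Fin 3 → ℤ) ∉ htgLattice m n l) :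
    HoneycombCover (HTG m n l) (htgLattice m n l) where
  proj := htgProj m n l
  sum_eq_zero _ hv := hv.1
  surj := htgProj_surj hm hn
  eq_iff _ _ hp hq := htgProj_eq_iff hm hn_even hparity hp hq
  adj_iff _ u hp := htg_adj_iff hm hn hn_even hparity hp u
  single_sub_single_notMem := h

/-! ### Local rigidity by counting short closed walks. -/

/-- Decides membership of `(a, b, c)` in `htgLattice m n l`. -/
def htgClosed (m n l : ℕ) (a b c : ℤ) : Bool :=
  decide (a + b + c = 0 ∧ c % m = 0 ∧ (a - b + l * (-c / m)) % n = 0)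

/-- Decides whether `(a, b, c)` is `0` or one of the two vectors `±(-(x + y), x, y)`. -/
def pairClosed (x y a b c : ℤ) : Bool :=
  decide (a + b + c = 0 ∧ ((b = 0 ∧ c = 0) ∨ (b = x ∧ c = y) ∨ (b = -x ∧ c = -y)))

/-- The vector `(-(x + y), x, y)` is a difference of two unit vectors, or the double of one. -/
def ShortRoot (x y : ℤ) : Prop :=
  (x = 0 ∨ y = 0 ∨ x + y = 0) ∧ -2 ≤ x ∧ x ≤ 2 ∧ -2 ≤ y ∧ y ≤ 2 ∧ ¬(x = 0 ∧ y = 0)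

instance (x y : ℤ) : Decidable (ShortRoot x y) := by unfold ShortRoot; infer_instance

set_option maxRecDepth 100000 in
-- In the honeycomb the closed walks of length six go round hexagons, whose colours repeat as t, s,
-- r, t, s, r; so 3-arcs with distinct colours lie on hexagons and those coloured t, s, t do not.
-- The finite check shows that this asymmetry survives one additional pair of short translations.
lemma locallyRigid_pairClosed : ∀ x ∈ Finset.Icc (-3 : ℤ) 3, ∀ y ∈ Finset.Icc (-3 : ℤ) 3,
    x + y ∈ Finset.Icc (-3 : ℤ) 3 → ¬ ShortRoot x y → LocallyRigid (pairClosed x y) 3 := by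
  decide +kernel

/-- Signs alternate, so of the remaining `j` steps `(j + (1 - x) / 2) / 2` are negative and `(j + (1
+ x) / 2) / 2` positive; the bounds say that the walk cannot end outside the window. -/
lemma closures_congr {P P' : ℤ → ℤ → ℤ → Bool} (hP : ∀ a b c : ℤ, -3 ≤ a → a ≤ 3 → -3 ≤ b → b ≤ 3 →
    -3 ≤ c → c ≤ 3 → P a b c = P' a b c) (c₁ : Fin 3) (j : ℕ) : ∀ (x a b c : ℤ) (s : Fin 3),
    x = 1 ∨ x = -1 →
    -3 ≤ a - (j + (1 - x) / 2) / 2 → a + (j + (1 + x) / 2) / 2 ≤ 3 →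
    -3 ≤ b - (j + (1 - x) / 2) / 2 → b + (j + (1 + x) / 2) / 2 ≤ 3 →
    -3 ≤ c - (j + (1 - x) / 2) / 2 → c + (j + (1 + x) / 2) / 2 ≤ 3 →
    closures P c₁ j x a b c s = closures P' c₁ j x a b c s := by
  induction j with
  | zero =>
    intro x a b c s hx h1 h2 h3 h4 h5 h6
    rw [closures, closures, hP a b c (by omega) (by omega) (by omega) (by omega) (by omega)
      (by omega)]
  | succ j ih =>
    intro x a b c s hx h1 h2 h3 h4 h5 h6
    push_cast at h1 h2 h3 h4 h5 h6
    rw [closures, closures,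
      ih (-x) (a + x) b c 0 (by omega) (by omega) (by omega) (by omega) (by omega) (by omega)
        (by omega),
      ih (-x) a (b + x) c 1 (by omega) (by omega) (by omega) (by omega) (by omega) (by omega)
        (by omega),
      ih (-x) a b (c + x) 2 (by omega) (by omega) (by omega) (by omega) (by omega) (by omega)
        (by omega)]

lemma LocallyRigid.congr {P P' : ℤ → ℤ → ℤ → Bool} (h : LocallyRigid P' 3)
    (hP : ∀ a b c : ℤ, -3 ≤ a → a ≤ 3 → -3 ≤ b → b ≤ 3 → -3 ≤ c → c ≤ 3 → P a b c = P' a b c) :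
    LocallyRigid P 3 := by
  have e : ∀ t s r, pathCount P 3 t s r = pathCount P' 3 t s r := by
    intro t s r
    rw [pathCount, pathCount]
    -- After three edges each coordinate lies between -1 and 2, and the remaining signs are -, +, -,
    -- so it ends between -3 and 3.
    refine closures_congr hP _ _ _ _ _ _ _ (Or.inr rfl) ?_ ?_ ?_ ?_ ?_ ?_ <;>
      (push_cast; split_ifs <;> norm_num)
  unfold LocallyRigid at *
  simpa only [e] using h

lemma htgClosed_iff {m n l : ℕ} (hm : 1 ≤ m) (v : Fin 3 → ℤ) :
    htgClosed m n l (v 0) (v 1) (v 2) = true ↔ v ∈ htgLattice m n l := by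
  have hm0 : (m : ℤ) ≠ 0 := by omega
  rw [htgClosed, decide_eq_true_iff, mem_htgLattice]
  refine and_congr Iff.rfl ?_
  rw [← Int.dvd_iff_emod_eq_zero, ← Int.dvd_iff_emod_eq_zero]
  constructor
  · rintro ⟨⟨k, hk⟩, h⟩
    refine ⟨-k, by linarith, ?_⟩
    rwa [show -v 2 = m * -k by linarith, Int.mul_ediv_cancel_left _ hm0] at h
  · rintro ⟨k, hk, h⟩
    refine ⟨⟨-k, by linarith⟩, ?_⟩
    rwa [show -v 2 = m * k by linarith, Int.mul_ediv_cancel_left _ hm0]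

/-- The covolume of the lattice divides determinants. -/
lemma dvd_det {m n l : ℕ} {v w : Fin 3 → ℤ} (hv : v ∈ htgLattice m n l)
    (hw : w ∈ htgLattice m n l) : (m * n : ℤ) ∣ 2 * (v 2 * w 1 - v 1 * w 2) := by
  obtain ⟨hv0, k, hk, a, ha⟩ := hv
  obtain ⟨hw0, k', hk', b, hb⟩ := hw
  refine ⟨k * b - k' * a, ?_⟩
  have e1 : 2 * v 1 = -v 2 - n * a + l * k := by linarith
  have e2 : 2 * w 1 = -w 2 - n * b + l * k' := by linarith
  have : 2 * (v 2 * w 1 - v 1 * w 2) = v 2 * (2 * w 1) - (2 * v 1) * w 2 := by ring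
  rw [this, e1, e2, hk, hk']
  ring

set_option maxRecDepth 100000 in
lemma eq_or_eq_neg_of_det_eq_zero : ∀ x ∈ Finset.Icc (-3 : ℤ) 3, ∀ y ∈ Finset.Icc (-3 : ℤ) 3,
    x + y ∈ Finset.Icc (-3 : ℤ) 3 → ∀ b ∈ Finset.Icc (-3 : ℤ) 3, ∀ c ∈ Finset.Icc (-3 : ℤ) 3,
    b + c ∈ Finset.Icc (-3 : ℤ) 3 → ¬ ShortRoot x y → ¬ ShortRoot b c → ¬ (x = 0 ∧ y = 0) →
    c * x - b * y = 0 → (b = 0 ∧ c = 0) ∨ (b = x ∧ c = y) ∨ (b = -x ∧ c = -y) := by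
  decide +kernel

set_option maxRecDepth 100000 in
lemma abs_det_lt : ∀ x ∈ Finset.Icc (-3 : ℤ) 3, ∀ y ∈ Finset.Icc (-3 : ℤ) 3,
    x + y ∈ Finset.Icc (-3 : ℤ) 3 → ∀ b ∈ Finset.Icc (-3 : ℤ) 3, ∀ c ∈ Finset.Icc (-3 : ℤ) 3,
    b + c ∈ Finset.Icc (-3 : ℤ) 3 → |2 * (c * x - b * y)| < 20 := by
  decide +kernel

lemma htgClosed_neg {m n l : ℕ} (hm : 1 ≤ m) {a b c : ℤ} (h : htgClosed m n l a b c = true) :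
    htgClosed m n l (-a) (-b) (-c) = true := by
  have h1 := (htgClosed_iff hm ![a, b, c]).1 h
  exact (htgClosed_iff hm (-![a, b, c])).2 (neg_mem h1)

/-- The lattice of a large honeycomb toroidal graph contains at most one pair of vectors that
contributes to the closed walks of length six. -/
lemma locallyRigid_of_le {m n l : ℕ} (hm : 1 ≤ m) (hmn : 20 ≤ m * n)
    (hroot : ∀ a x y, htgClosed m n l a x y = true → ¬ ShortRoot x y) :
    LocallyRigid (htgClosed m n l) 3 := by
  have hsum : ∀ {a b c}, htgClosed m n l a b c = true → a + b + c = 0 := by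
    intro a b c h
    rw [htgClosed, decide_eq_true_iff] at h
    exact h.1
  have hmem : ∀ {a b c}, htgClosed m n l a b c = true → ![a, b, c] ∈ htgLattice m n l :=
    fun {a b c} h => (htgClosed_iff hm ![a, b, c]).1 h
  have hzero : htgClosed m n l 0 0 0 = true := by simp [htgClosed]
  obtain ⟨x, y, hx, hy, hxy, hr, hP⟩ : ∃ x y : ℤ, x ∈ Finset.Icc (-3 : ℤ) 3 ∧
      y ∈ Finset.Icc (-3 : ℤ) 3 ∧ x + y ∈ Finset.Icc (-3 : ℤ) 3 ∧ ¬ ShortRoot x y ∧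
      ∀ a b c : ℤ, -3 ≤ a → a ≤ 3 → -3 ≤ b → b ≤ 3 → -3 ≤ c → c ≤ 3 →
        htgClosed m n l a b c = pairClosed x y a b c := by
    by_cases hex : ∃ a x y : ℤ, x ∈ Finset.Icc (-3 : ℤ) 3 ∧ y ∈ Finset.Icc (-3 : ℤ) 3 ∧
        x + y ∈ Finset.Icc (-3 : ℤ) 3 ∧ ¬ (x = 0 ∧ y = 0) ∧ htgClosed m n l a x y = true
    · obtain ⟨z, x, y, hx, hy, hxy, hne, hz⟩ := hex
      refine ⟨x, y, hx, hy, hxy, hroot _ _ _ hz, fun a b c ha ha' hb hb' hc hc' => ?_⟩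
      rw [Bool.eq_iff_iff, pairClosed, decide_eq_true_iff]
      constructor
      · intro h
        have h0 := hsum h
        refine ⟨h0, ?_⟩
        have hb2 : b ∈ Finset.Icc (-3 : ℤ) 3 := Finset.mem_Icc.2 ⟨hb, hb'⟩
        have hc2 : c ∈ Finset.Icc (-3 : ℤ) 3 := Finset.mem_Icc.2 ⟨hc, hc'⟩
        have hbc : b + c ∈ Finset.Icc (-3 : ℤ) 3 := Finset.mem_Icc.2 ⟨by omega, by omega⟩
        refine eq_or_eq_neg_of_det_eq_zero x hx y hy hxy b hb2 c hc2 hbc (hroot _ _ _ hz)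
          (hroot _ _ _ h) hne ?_
        have hd : (m * n : ℤ) ∣ 2 * (c * x - b * y) := by simpa using dvd_det (hmem h) (hmem hz)
        have := Int.eq_zero_of_abs_lt_dvd hd
          (lt_of_lt_of_le (abs_det_lt x hx y hy hxy b hb2 c hc2 hbc) (by exact_mod_cast hmn))
        omega
      · have hz0 := hsum hz
        rintro ⟨h0, ⟨rfl, rfl⟩ | ⟨rfl, rfl⟩ | ⟨rfl, rfl⟩⟩
        · obtain rfl : a = 0 := by omega
          exact hzero
        · obtain rfl : a = z := by omega
          exact hz
        · obtain rfl : a = -z := by omega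
          exact htgClosed_neg hm hz
    -- With no nonzero vector of Λ in the window, the pair degenerates to the zero vector.
    · refine ⟨0, 0, by decide, by decide, by decide, by decide, fun a b c ha ha' hb hb' hc hc' => ?_⟩
      rw [Bool.eq_iff_iff, pairClosed, decide_eq_true_iff]
      constructor
      · intro h
        have h0 := hsum h
        refine ⟨h0, Or.inl ?_⟩
        by_contra hne
        exact hex ⟨a, b, c, Finset.mem_Icc.2 ⟨hb, hb'⟩, Finset.mem_Icc.2 ⟨hc, hc'⟩,
          Finset.mem_Icc.2 ⟨by omega, by omega⟩, hne, h⟩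
      · rintro ⟨h0, h⟩
        obtain ⟨rfl, rfl⟩ : b = 0 ∧ c = 0 := by omega
        obtain rfl : a = 0 := by omega
        exact hzero
  exact (locallyRigid_pairClosed x hx y hy hxy hr).congr hP

section NonExceptional

variable {m n l : ℕ} (hm : 1 ≤ m) (hn : 4 ≤ n) (hn_even : Even n) (hl : l ≤ n / 2)
  (hparity : l % 2 = m % 2) (hcubic : ¬(m = 1 ∧ l = 1)) (hexc : ¬IsExceptional m n l)

include hm hn hn_even hl hparity hcubic hexc

/-- The generalized prisms are excluded. -/
lemma not_prism : n ≠ 4 ∧ ¬(m = 1 ∧ n = 2 * l + 2) ∧ ¬(m = 2 ∧ l = 2) := by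
  unfold IsExceptional at hexc
  simp only [not_or, not_exists] at hexc
  obtain ⟨-, ⟨e2, e3, e4⟩, -, -, -, e9⟩ := hexc
  refine ⟨?_, ?_, ?_⟩
  · rintro rfl
    have : ¬ 2 < m := fun h => e9 m ⟨h, by ring, Or.inl rfl⟩
    clear e9
    omega
  · rintro ⟨rfl, rfl⟩
    have : ¬ 2 < (l + 1) / 2 := fun h =>
      e9 ((l + 1) / 2) ⟨h, by omega, Or.inr (Or.inl ⟨rfl, by omega, by omega⟩)⟩
    clear e9
    omega
  · rintro ⟨rfl, rfl⟩
    obtain ⟨n', rfl⟩ := hn_even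
    have : ¬ 2 < n' := fun h => e9 n' ⟨h, by ring, Or.inr (Or.inr ⟨rfl, by ring, rfl⟩)⟩
    clear e9
    omega

/-- These vectors would close 4-cycles whose edges alternate between two colours. Given the bound on
`l`, each possibility leads to a generalized prism or contradicts the hypotheses. -/
lemma double_root_notMem :
    ![2, -2, 0] ∉ htgLattice m n l ∧ ![2, 0, -2] ∉ htgLattice m n l ∧
      ![0, 2, -2] ∉ htgLattice m n l := by
  obtain ⟨e1, e2, e3⟩ := not_prism hm hn hn_even hl hparity hcubic hexc
  clear hexc
  have hm2 : ∀ k : ℤ, (m : ℤ) * k = 2 → (m = 1 ∧ k = 2) ∨ (m = 2 ∧ k = 1) := by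
    intro k hk1
    have hm' : (m : ℤ) ≤ 2 := Int.le_of_dvd (by norm_num) ⟨k, hk1.symm⟩
    have : m = 1 ∨ m = 2 := by omega
    rcases this with rfl | rfl
    · left; omega
    · right; omega
  -- Since `l ≤ n / 2`, the multiples of `n` that occur below are too small to be anything but `n`
  -- itself.
  have small : ∀ x : ℤ, (n : ℤ) ∣ x → 0 < x → x < 2 * n → x = n := by
    rintro x ⟨k, rfl⟩ h1 h2
    have : 0 < k := by by_contra h; nlinarith
    have : k < 2 := by by_contra h; nlinarith
    obtain rfl : k = 1 := by omega
    simp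
  refine ⟨fun h => ?_, fun h => ?_, fun h => ?_⟩
  · obtain ⟨-, k, hk, h⟩ := h
    simp only [Matrix.cons_val] at hk h
    have hk0 : k = 0 := by
      have : (m : ℤ) * k = 0 := by linarith
      rcases mul_eq_zero.1 this with h | h
      · omega
      · exact h
    rw [hk0] at h
    have := small _ h (by norm_num) (by omega)
    omega
  · obtain ⟨-, k, hk, h⟩ := h
    simp only [Matrix.cons_val] at hk h
    rcases hm2 k (by linarith) with ⟨rfl, rfl⟩ | ⟨rfl, rfl⟩
    · have := small _ h (by omega) (by omega)
      omega
    · have := small _ h (by omega) (by omega)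
      omega
  · obtain ⟨-, k, hk, h⟩ := h
    simp only [Matrix.cons_val] at hk h
    rcases hm2 k (by linarith) with ⟨rfl, rfl⟩ | ⟨rfl, rfl⟩
    · have := small _ h (by omega) (by omega)
      omega
    · rcases Nat.eq_zero_or_pos l with rfl | hl0
      · have := small _ (dvd_neg.2 h) (by omega) (by omega)
        omega
      · have := small _ h (by omega) (by omega)
        omega

lemma not_shortRoot (a x y : ℤ) (h : htgClosed m n l a x y = true) : ¬ ShortRoot x y := by
  obtain ⟨h1, h2, h3⟩ := double_root_notMem hm hn hn_even hl hparity hcubic hexc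
  have hs : a + x + y = 0 := by
    rw [htgClosed, decide_eq_true_iff] at h
    exact h.1
  have hv := (htgClosed_iff hm ![a, x, y]).1 h
  have key : ∀ z : ℤ, -2 ≤ z → z ≤ 2 → z ≠ 0 → ∃ k, k * z = -2 := by
    intro z h1 h2 h3
    have : z = -2 ∨ z = -1 ∨ z = 1 ∨ z = 2 := by omega
    rcases this with rfl | rfl | rfl | rfl
    · exact ⟨1, by norm_num⟩
    · exact ⟨2, by norm_num⟩
    · exact ⟨-2, by norm_num⟩
    · exact ⟨-1, by norm_num⟩
  rintro ⟨rfl | rfl | hxy, hx, hx', hy, hy', hne⟩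
  · obtain ⟨k, hk⟩ := key y hy hy' (by omega)
    obtain rfl : a = -y := by omega
    refine h2 ?_
    convert zsmul_mem hv k using 1
    ext i; fin_cases i <;> simp <;> linarith
  · obtain ⟨k, hk⟩ := key x hx hx' (by omega)
    obtain rfl : a = -x := by omega
    refine h1 ?_
    convert zsmul_mem hv k using 1
    ext i; fin_cases i <;> simp <;> linarith
  · obtain ⟨k, hk⟩ := key y hy hy' (by omega)
    obtain rfl : x = -y := by omega
    obtain rfl : a = 0 := by omega
    refine h3 ?_
    convert zsmul_mem hv k using 1
    ext i; fin_cases i <;> simp <;> linarith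

lemma single_sub_single_notMem (s t : Fin 3) (hst : s ≠ t) :
    (Pi.single s 1 - Pi.single t 1 : Fin 3 → ℤ) ∉ htgLattice m n l := by
  intro h
  rw [← htgClosed_iff hm] at h
  refine not_shortRoot hm hn hn_even hl hparity hcubic hexc _ _ _ h ?_
  have key : ∀ s t : Fin 3, s ≠ t → ShortRoot ((Pi.single s 1 - Pi.single t 1 : Fin 3 → ℤ) 1)
      ((Pi.single s 1 - Pi.single t 1 : Fin 3 → ℤ) 2) := by decide
  exact key s t hst

end NonExceptional

set_option maxRecDepth 100000 in
-- Below mn = 20 the determinant bound fails and several short vectors may coexist, so the finitely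
-- many graphs, with k = n/2, are checked with walks of length six or eight.
lemma locallyRigid_small : ∀ m ∈ Finset.Icc 1 4, ∀ k ∈ Finset.Icc 3 9, ∀ l ∈ Finset.Icc 0 k,
    (m * (k + k) < 20 ∧ l % 2 = m % 2 ∧ ¬(m = 1 ∧ l = 1) ∧ ¬(m = 1 ∧ k + k = 6 ∧ l = 3) ∧
      ¬(m = 1 ∧ k + k = 8 ∧ l = 3) ∧ ¬(m = 1 ∧ k + k = 14 ∧ l = 5) ∧
      ¬(m = 1 ∧ k + k = 16 ∧ l = 5) ∧ ¬(m = 2 ∧ k + k = 8 ∧ l = 4) ∧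
      ¬(m = 3 ∧ k + k = 6 ∧ l = 3) ∧ ¬(m = 1 ∧ k + k = 2 * l + 2) ∧ ¬(m = 2 ∧ l = 2)) →
    LocallyRigid (htgClosed m (k + k) l) 3 ∨ LocallyRigid (htgClosed m (k + k) l) 5 := by
  decide +kernel

/-- Honeycomb toroidal graphs outside the list of exceptions are locally rigid. -/
theorem exists_locallyRigid {m n l : ℕ} (hm : 1 ≤ m) (hn : 4 ≤ n) (hn_even : Even n)
    (hl : l ≤ n / 2) (hparity : l % 2 = m % 2) (hcubic : ¬(m = 1 ∧ l = 1))
    (hexc : ¬IsExceptional m n l) : ∃ j, LocallyRigid (htgClosed m n l) j := by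
  rcases Nat.lt_or_ge (m * n) 20 with hlt | hge
  · obtain ⟨f1, f2, f3⟩ := not_prism hm hn hn_even hl hparity hcubic hexc
    obtain ⟨k, rfl⟩ := hn_even
    have hm4 : m ∈ Finset.Icc 1 4 := by
      rw [Finset.mem_Icc]
      refine ⟨hm, ?_⟩
      by_contra h
      have := Nat.mul_le_mul (show 5 ≤ m by omega) hn
      omega
    have hk9 : k ∈ Finset.Icc 3 9 := by
      rw [Finset.mem_Icc]
      have := Nat.mul_le_mul hm (le_refl (k + k))
      omega
    have hlk : l ∈ Finset.Icc 0 k := by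
      rw [Finset.mem_Icc]
      omega
    unfold IsExceptional at hexc
    simp only [not_or] at hexc
    obtain ⟨e1, ⟨e2, e3, e4⟩, e5, ⟨e6, e7⟩, e8, -⟩ := hexc
    rcases locallyRigid_small m hm4 k hk9 l hlk
      ⟨hlt, hparity, hcubic, e1, e4, e5, e6, e7, e8, f2, f3⟩ with H | H <;> exact ⟨_, H⟩
  · exact ⟨3, locallyRigid_of_le hm hge (not_shortRoot hm hn hn_even hl hparity hcubic hexc)⟩

/-! ### Colour permutations preserving the lattice, and the arithmetic conditions. -/

/-- The cyclic permutation of the colours. -/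
def rot : Equiv.Perm (Fin 3) := finRotate 3

lemma perm_cases : ∀ σ : Equiv.Perm (Fin 3), σ = 1 ∨ σ = Equiv.swap 0 1 ∨ σ = Equiv.swap 0 2 ∨
    σ = Equiv.swap 1 2 ∨ σ = rot ∨ σ = rot.symm := by
  decide

lemma preservedBy_one (Λ : AddSubgroup (Fin 3 → ℤ)) : PreservedBy Λ 1 := fun _ => Iff.rfl

lemma preservedBy_symm_iff {Λ : AddSubgroup (Fin 3 → ℤ)} {σ : Equiv.Perm (Fin 3)} :
    PreservedBy Λ σ.symm ↔ PreservedBy Λ σ :=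
  ⟨fun h => by simpa using h.symm, fun h => h.symm⟩

/-- For a permutation of order dividing six it is enough that `Λ` is mapped into itself. -/
lemma preservedBy_iff {Λ : AddSubgroup (Fin 3 → ℤ)} {σ : Equiv.Perm (Fin 3)} :
    PreservedBy Λ σ ↔ ∀ v ∈ Λ, (fun i => v (σ i)) ∈ Λ := by
  refine ⟨fun h v hv => (h v).2 hv, fun h v => ⟨fun hv => ?_, fun hv => h v hv⟩⟩
  have h6 : ∀ (σ : Equiv.Perm (Fin 3)) i, σ (σ (σ (σ (σ (σ i))))) = i := by
    decide +kernel
  have := h _ (h _ (h _ (h _ (h _ hv))))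
  simpa [h6] using this

section Frame

variable {m n l : ℕ}

/-- The half period and the unit glide of the lattice. -/
lemma generators_mem (hn_even : Even n) (hparity : l % 2 = m % 2) :
    ![(n : ℤ) / 2, -((n : ℤ) / 2), 0] ∈ htgLattice m n l ∧
      ![((m : ℤ) - l) / 2, (m + l) / 2, -m] ∈ htgLattice m n l := by
  obtain ⟨k, rfl⟩ := hn_even
  refine ⟨⟨by simp, 0, by simp, 1, ?_⟩, ⟨by simp; omega, 1, by simp, 0, ?_⟩⟩
  · simp; omega
  · simp; omega

lemma preservedBy_swap_zero_one_iff (hm : 1 ≤ m) (hn_even : Even n) (hparity : l % 2 = m % 2) :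
    PreservedBy (htgLattice m n l) (Equiv.swap 0 1) ↔ (n : ℤ) ∣ 2 * l := by
  have hm0 : (m : ℤ) ≠ 0 := by omega
  have a0 : Equiv.swap (0 : Fin 3) 1 0 = 1 := by decide
  have a1 : Equiv.swap (0 : Fin 3) 1 1 = 0 := by decide
  have a2 : Equiv.swap (0 : Fin 3) 1 2 = 2 := by decide
  rw [preservedBy_iff]
  constructor
  · intro h
    obtain ⟨-, k, hk, x, hx⟩ := h _ (generators_mem hn_even hparity).2
    simp only [a0, a1, a2, Matrix.cons_val] at hk hx
    obtain rfl : 1 = k := mul_left_cancel₀ hm0 (by linarith)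
    exact ⟨x, by rw [← hx]; omega⟩
  · rintro ⟨x, hx⟩ v ⟨h0, k, hk, y, hy⟩
    refine ⟨?_, k, ?_, x * k - y, ?_⟩ <;> simp only [a0, a1, a2]
    · linarith
    · exact hk
    · linear_combination k * hx - hy

/-- After division by m, Λ consists of the sum-zero vectors that are multiples of (t, -(t+1), 1) mod
q. A permutation preserves it exactly when it maps this direction to a multiple of itself, which is
one congruence for t. -/
lemma mem_htgLattice_iff {q t : ℤ} (hq : (n : ℤ) = 2 * m * q)
    (ht : (l : ℤ) = m + 2 * m * t) (v : Fin 3 → ℤ) : v ∈ htgLattice m n l ↔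
      ∃ a b c : ℤ, v 0 = m * a ∧ v 1 = m * b ∧ v 2 = m * c ∧ a + b + c = 0 ∧ q ∣ a - t * c := by
  constructor
  · rintro ⟨h0, k, hk, x, hx⟩
    rw [hq, ht] at hx
    have h2 : 2 * v 0 = 2 * (m * (q * x - t * k)) := by linear_combination h0 + hx - hk
    have h3 : v 0 = m * (q * x - t * k) := by linarith
    refine ⟨q * x - t * k, k - (q * x - t * k), -k, h3, ?_, ?_, by ring, x, by ring⟩
    · linear_combination h0 - h3 - hk
    · rw [hk]; ring
  · rintro ⟨a, b, c, h0, h1, h2, habc, x, hx⟩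
    refine ⟨by rw [h0, h1, h2, ← mul_add, ← mul_add, habc, mul_zero], -c, by rw [h2]; ring, x, ?_⟩
    rw [h0, h1, hq, ht]
    linear_combination 2 * m * hx - m * habc

/-- There are `q` and `t` with `n = 2mq` and `l = m + 2mt` such that `q` divides `f t`. -/
def Frame (m n l : ℕ) (f : ℤ → ℤ) : Prop :=
  ∃ q t : ℤ, (n : ℤ) = 2 * m * q ∧ (l : ℤ) = m + 2 * m * t ∧ q ∣ f t

lemma frame_iff (hm : 1 ≤ m) {f : ℤ → ℤ} {q t : ℤ} (hq : (n : ℤ) = 2 * m * q)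
    (ht : (l : ℤ) = m + 2 * m * t) : Frame m n l f ↔ q ∣ f t := by
  have hm0 : (2 * m : ℤ) ≠ 0 := by omega
  constructor
  · rintro ⟨q', t', hq', ht', h⟩
    obtain rfl : q = q' := mul_left_cancel₀ hm0 (by rw [← hq, hq'])
    obtain rfl : t = t' := mul_left_cancel₀ hm0 (by linarith)
    exact h
  · exact fun h => ⟨q, t, hq, ht, h⟩

lemma glide_mem {q t : ℤ} (hq : (n : ℤ) = 2 * m * q)
    (ht : (l : ℤ) = m + 2 * m * t) : ![m * t, -(m * (t + 1)), (m : ℤ)] ∈ htgLattice m n l := by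
  rw [mem_htgLattice_iff hq ht]
  exact ⟨t, -(t + 1), 1, by simp, by simp; ring, by simp, by ring, 0, by ring⟩

lemma preservedBy_swap_zero_two_iff (hm : 1 ≤ m) (hn_even : Even n) (hparity : l % 2 = m % 2) :
    PreservedBy (htgLattice m n l) (Equiv.swap 0 2) ↔ Frame m n l fun t => t ^ 2 - 1 := by
  have hm0 : (m : ℤ) ≠ 0 := by omega
  have a0 : Equiv.swap (0 : Fin 3) 2 0 = 2 := by decide
  have a1 : Equiv.swap (0 : Fin 3) 2 1 = 1 := by decide
  have a2 : Equiv.swap (0 : Fin 3) 2 2 = 0 := by decide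
  rw [preservedBy_iff]
  constructor
  · intro h
    obtain ⟨g1, g2⟩ := generators_mem hn_even hparity
    -- Third coordinates in Λ are multiples of m. Moving another coordinate of the generators there
    -- shows that m divides n/2 and (m - l)/2, which produces q and t.
    obtain ⟨-, k, hk, -⟩ := h _ g1
    obtain ⟨-, k', hk', -⟩ := h _ g2
    simp only [a2, Matrix.cons_val] at hk hk'
    obtain ⟨n', hn'⟩ := hn_even
    have hq : (n : ℤ) = 2 * m * (-k) := by
      rw [mul_assoc, mul_neg, ← hk]; omega
    have ht : (l : ℤ) = m + 2 * m * k' := by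
      rw [mul_assoc, ← neg_eq_iff_eq_neg.2 hk']; omega
    rw [frame_iff hm hq ht]
    obtain ⟨a, b, c, h0, h1, h2, habc, x, hx⟩ :=
      (mem_htgLattice_iff hq ht _).1 (h _ (glide_mem hq ht))
    simp only [a0, a1, a2, Matrix.cons_val] at h0 h1 h2
    obtain rfl : 1 = a := mul_left_cancel₀ hm0 (by linarith)
    obtain rfl : k' = c := mul_left_cancel₀ hm0 h2
    exact ⟨-x, by linear_combination -hx⟩
  · rintro ⟨q, t, hq, ht, y, hy⟩ v hv
    rw [mem_htgLattice_iff hq ht] at hv ⊢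
    obtain ⟨a, b, c, h0, h1, h2, habc, x, hx⟩ := hv
    simp only [a0, a1, a2]
    exact ⟨c, b, a, h2, h1, h0, by linarith, -t * x - c * y, by linear_combination -t * hx - c * hy⟩

lemma preservedBy_swap_one_two_iff (hm : 1 ≤ m) (hn_even : Even n) (hparity : l % 2 = m % 2) :
    PreservedBy (htgLattice m n l) (Equiv.swap 1 2) ↔ Frame m n l fun t => t ^ 2 + 2 * t := by
  have hm0 : (m : ℤ) ≠ 0 := by omega
  have a0 : Equiv.swap (1 : Fin 3) 2 0 = 0 := by decide
  have a1 : Equiv.swap (1 : Fin 3) 2 1 = 2 := by decide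
  have a2 : Equiv.swap (1 : Fin 3) 2 2 = 1 := by decide
  rw [preservedBy_iff]
  constructor
  · intro h
    obtain ⟨g1, g2⟩ := generators_mem hn_even hparity
    obtain ⟨-, k, hk, -⟩ := h _ g1
    obtain ⟨-, k', hk', -⟩ := h _ g2
    simp only [a2, Matrix.cons_val] at hk hk'
    obtain ⟨n', hn'⟩ := hn_even
    have hq : (n : ℤ) = 2 * m * k := by
      have : (m : ℤ) * k = n / 2 := by linarith
      rw [mul_assoc, this]; omega
    have ht : (l : ℤ) = m + 2 * m * (-k' - 1) := by
      have : (m : ℤ) * k' = -((m + l) / 2) := by linarith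
      rw [show (m : ℤ) + 2 * m * (-k' - 1) = -m - 2 * (m * k') by ring, this]; omega
    rw [frame_iff hm hq ht]
    obtain ⟨a, b, c, h0, h1, h2, habc, x, hx⟩ :=
      (mem_htgLattice_iff hq ht _).1 (h _ (glide_mem hq ht))
    simp only [a0, a1, a2, Matrix.cons_val] at h0 h1 h2
    generalize -k' - 1 = t at *
    obtain rfl : t = a := mul_left_cancel₀ hm0 h0
    obtain rfl : -(t + 1) = c := mul_left_cancel₀ hm0 (by linarith)
    exact ⟨x, by linear_combination hx⟩
  · rintro ⟨q, t, hq, ht, y, hy⟩ v hv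
    rw [mem_htgLattice_iff hq ht] at hv ⊢
    obtain ⟨a, b, c, h0, h1, h2, habc, x, hx⟩ := hv
    simp only [a0, a1, a2]
    refine ⟨a, c, b, h0, h2, h1, by linarith, (1 + t) * x + c * y, ?_⟩
    linear_combination (1 + t) * hx + c * hy - t * habc

lemma preservedBy_rot_iff (hm : 1 ≤ m) (hn_even : Even n) (hparity : l % 2 = m % 2) :
    PreservedBy (htgLattice m n l) rot ↔ Frame m n l fun t => t ^ 2 + t + 1 := by
  have hm0 : (m : ℤ) ≠ 0 := by omega
  have a0 : rot 0 = 1 := by decide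
  have a1 : rot 1 = 2 := by decide
  have a2 : rot 2 = 0 := by decide
  rw [preservedBy_iff]
  constructor
  · intro h
    obtain ⟨g1, g2⟩ := generators_mem hn_even hparity
    obtain ⟨-, k, hk, -⟩ := h _ g1
    obtain ⟨-, k', hk', -⟩ := h _ g2
    simp only [a2, Matrix.cons_val] at hk hk'
    obtain ⟨n', hn'⟩ := hn_even
    have hq : (n : ℤ) = 2 * m * (-k) := by
      rw [mul_assoc, mul_neg, ← hk]; omega
    have ht : (l : ℤ) = m + 2 * m * k' := by
      rw [mul_assoc, ← neg_eq_iff_eq_neg.2 hk']; omega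
    rw [frame_iff hm hq ht]
    obtain ⟨a, b, c, h0, h1, h2, habc, x, hx⟩ :=
      (mem_htgLattice_iff hq ht _).1 (h _ (glide_mem hq ht))
    simp only [a0, a1, a2, Matrix.cons_val] at h0 h1 h2
    obtain rfl : -(k' + 1) = a := mul_left_cancel₀ hm0 (by linarith)
    obtain rfl : k' = c := mul_left_cancel₀ hm0 h2
    exact ⟨-x, by linear_combination -hx⟩
  · rintro ⟨q, t, hq, ht, y, hy⟩ v hv
    rw [mem_htgLattice_iff hq ht] at hv ⊢
    obtain ⟨a, b, c, h0, h1, h2, habc, x, hx⟩ := hv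
    simp only [a0, a1, a2]
    refine ⟨b, c, a, h1, h2, h0, by linarith, -(1 + t) * x - c * y, ?_⟩
    linear_combination -(1 + t) * hx - c * hy + habc

lemma exists_frame_of_gcd {x : ℤ} (h : Int.gcd n x = 2 * m) :
    ∃ q y : ℤ, (n : ℤ) = 2 * m * q ∧ x = 2 * m * y := by
  have h1 : (2 * m : ℤ) ∣ n := by
    have := Int.gcd_dvd_left (n : ℤ) x
    rw [h] at this; exact_mod_cast this
  have h2 : (2 * m : ℤ) ∣ x := by
    have := Int.gcd_dvd_right (n : ℤ) x
    rw [h] at this; exact_mod_cast this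
  obtain ⟨q, hq⟩ := h1
  obtain ⟨y, hy⟩ := h2
  exact ⟨q, y, hq, hy⟩

lemma gcd_eq_of_isCoprime {q y : ℤ} (h : IsCoprime q y) :
    Int.gcd (2 * m * q) (2 * m * y) = 2 * m := by
  rw [Int.gcd_mul_left, Int.isCoprime_iff_gcd_eq_one.1 h, mul_one]
  omega

/-- Substituting l = m + 2mt gives l² - 2ml - 3m² = 4m²(t² - 1), while 2mn = 4m²q. Conversely, the
congruence makes t invertible mod q, so the gcd is exactly 2m. The conditions (c1) and (c4) are
treated in the same way. -/
lemma c2_iff (hm : 1 ≤ m) : C2 m n l ↔ Frame m n l fun t => t ^ 2 - 1 := by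
  have hm0 : (4 * m ^ 2 : ℤ) ≠ 0 := by positivity
  unfold C2
  constructor
  · rintro ⟨h, h'⟩
    obtain ⟨q, t, hq, ht⟩ := exists_frame_of_gcd h
    have ht : (l : ℤ) = m + 2 * m * t := by linarith
    refine ⟨q, t, hq, ht, ?_⟩
    rw [hq, ht] at h'
    refine (mul_dvd_mul_iff_left hm0).1 ?_
    obtain ⟨x, hx⟩ := h'
    exact ⟨x, by linear_combination hx⟩
  · rintro ⟨q, t, hq, ht, x, hx⟩
    rw [hq, ht]
    refine ⟨?_, x, by linear_combination 4 * (m : ℤ) ^ 2 * hx⟩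
    rw [add_sub_cancel_left]
    exact gcd_eq_of_isCoprime ⟨-x, t, by linear_combination hx⟩

lemma c1_iff (hm : 1 ≤ m) : C1 m n l ↔ Frame m n l fun t => t ^ 2 + 2 * t := by
  have hm0 : (4 * m ^ 2 : ℤ) ≠ 0 := by positivity
  unfold C1
  constructor
  · rintro ⟨h, h'⟩
    obtain ⟨q, t, hq, ht⟩ := exists_frame_of_gcd h
    have ht : (l : ℤ) = m + 2 * m * (t - 1) := by linarith
    refine ⟨q, t - 1, hq, ht, ?_⟩
    rw [hq, ht] at h'
    refine (mul_dvd_mul_iff_left hm0).1 ?_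
    obtain ⟨x, hx⟩ := h'
    exact ⟨x, by linear_combination hx⟩
  · rintro ⟨q, t, hq, ht, x, hx⟩
    rw [hq, ht]
    refine ⟨?_, x, by linear_combination 4 * (m : ℤ) ^ 2 * hx⟩
    rw [show (m : ℤ) + 2 * m * t + m = 2 * m * (t + 1) by ring]
    exact gcd_eq_of_isCoprime ⟨-x, t + 1, by linear_combination hx⟩

lemma c4_iff (hm : 1 ≤ m) : C4 m n l ↔ Frame m n l fun t => t ^ 2 + t + 1 := by
  have hm0 : (4 * m ^ 2 : ℤ) ≠ 0 := by positivity
  unfold C4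
  constructor
  · rintro ⟨-, h, h'⟩
    obtain ⟨q, t, hq, ht⟩ := exists_frame_of_gcd h
    have ht : (l : ℤ) = m + 2 * m * t := by linarith
    refine ⟨q, t, hq, ht, ?_⟩
    rw [hq, ht] at h'
    refine (mul_dvd_mul_iff_left hm0).1 ?_
    obtain ⟨x, hx⟩ := h'
    exact ⟨x, by linear_combination hx⟩
  · rintro ⟨q, t, hq, ht, x, hx⟩
    rw [hq, ht]
    refine ⟨?_, ?_, x, by linear_combination 4 * (m : ℤ) ^ 2 * hx⟩
    · rw [show (m : ℤ) + 2 * m * t + m = 2 * m * (t + 1) by ring]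
      exact gcd_eq_of_isCoprime ⟨x, -t, by linear_combination -hx⟩
    · rw [add_sub_cancel_left]
      exact gcd_eq_of_isCoprime ⟨x, -(t + 1), by linear_combination -hx⟩

lemma c3_iff (hn : 4 ≤ n) (hn_even : Even n) (hl : l ≤ n / 2) : C3 n l ↔ (n : ℤ) ∣ 2 * l := by
  obtain ⟨k, rfl⟩ := hn_even
  unfold C3
  constructor
  · rintro (rfl | h)
    · simp
    · exact ⟨1, by omega⟩
  · rintro ⟨x, hx⟩
    have hl' : (l : ℤ) ≤ k := by omega
    have hk : (2 : ℤ) ≤ k := by omega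
    have h0 : 0 ≤ x := by by_contra h; push_cast at hx; nlinarith
    have h1 : x < 2 := by by_contra h; push_cast at hx; nlinarith
    have : x = 0 ∨ x = 1 := by omega
    rcases this with rfl | rfl <;> omega

/-- The divisibility conditions behind two of the four symmetries leave only two possibilities. -/
lemma eq_of_frame (hm : 1 ≤ m) (hn : 4 ≤ n) (hl : l ≤ n / 2) {q t : ℤ}
    (hq : (n : ℤ) = 2 * m * q) (ht : (l : ℤ) = m + 2 * m * t) (h1 : q ∣ 2 * t + 1) (h3 : q ∣ 3) :
    (n = 2 * m ∧ l = m) ∨ (n = 6 * m ∧ l = 3 * m) := by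
  have hl' : 2 * (l : ℤ) ≤ n := by omega
  have hq0 : 0 < q := by by_contra h; nlinarith
  have hq3 : q ≤ 3 := Int.le_of_dvd (by norm_num) h3
  have ht0 : 0 ≤ t := by by_contra h; nlinarith
  have : q = 1 ∨ q = 2 ∨ q = 3 := by omega
  rcases this with rfl | rfl | rfl
  · have : t < 1 := by by_contra h; nlinarith
    obtain rfl : t = 0 := by omega
    omega
  · omega
  · have : t < 2 := by
      by_contra h
      have h2 : (m : ℤ) * 2 ≤ m * t := by nlinarith
      rw [mul_assoc] at ht hq
      omega
    obtain rfl : t = 1 := by omega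
    omega

lemma all_of_eq (hm : 1 ≤ m)
    (h : (n = 2 * m ∧ l = m) ∨ (n = 6 * m ∧ l = 3 * m)) :
    C1 m n l ∧ C2 m n l ∧ C3 n l ∧ C4 m n l := by
  rw [c1_iff hm, c2_iff hm, c4_iff hm]
  rcases h with ⟨hn', hl'⟩ | ⟨hn', hl'⟩
  · have hq : (n : ℤ) = 2 * m * 1 := by omega
    have ht : (l : ℤ) = m + 2 * m * 0 := by omega
    rw [frame_iff hm hq ht, frame_iff hm hq ht, frame_iff hm hq ht]
    exact ⟨one_dvd _, one_dvd _, Or.inr (by omega), one_dvd _⟩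
  · have hq : (n : ℤ) = 2 * m * 3 := by omega
    have ht : (l : ℤ) = m + 2 * m * 1 := by omega
    rw [frame_iff hm hq ht, frame_iff hm hq ht, frame_iff hm hq ht]
    exact ⟨by norm_num, by norm_num, Or.inr (by omega), by norm_num⟩

/-- The conditions say that q divides t² + 2t, t² - 1, 2t + 1 and t² + t + 1 respectively. Any two
of these polynomials generate an ideal of ℤ[t] that contains both 2t + 1 and 3; the witnesses are
the explicit combinations. -/
lemma eq_of_atLeastTwo (hm : 1 ≤ m) (hn : 4 ≤ n) (hn_even : Even n) (hl : l ≤ n / 2)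
    (h : AtLeastTwo (C1 m n l) (C2 m n l) (C3 n l) (C4 m n l)) :
    (n = 2 * m ∧ l = m) ∨ (n = 6 * m ∧ l = 3 * m) := by
  have key : ∀ {q t : ℤ}, (n : ℤ) = 2 * m * q → (l : ℤ) = m + 2 * m * t → C3 n l →
      q ∣ 2 * t + 1 := by
    intro q t hq ht h
    rw [c3_iff hn hn_even hl, hq, ht] at h
    have hm0 : (2 * m : ℤ) ≠ 0 := by omega
    refine (mul_dvd_mul_iff_left hm0).1 ?_
    obtain ⟨x, hx⟩ := h
    exact ⟨x, by linear_combination hx⟩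
  unfold AtLeastTwo at h
  rw [c1_iff hm, c2_iff hm, c4_iff hm] at h
  rcases h with ⟨h, h'⟩ | ⟨h, h'⟩ | ⟨h, h'⟩ | ⟨h, h'⟩ | ⟨h, h'⟩ | ⟨h', h⟩ <;>
    obtain ⟨q, t, hq, ht, x, hx⟩ := h
  · obtain ⟨y, hy⟩ := (frame_iff hm hq ht).1 h'
    refine eq_of_frame hm hn hl hq ht ⟨x - y, by linear_combination hx - hy⟩
      ⟨(x - y) * (2 * t - 1) - 4 * y, by linear_combination (2 * t - 1) * (hx - hy) - 4 * hy⟩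
  · obtain ⟨y, hy⟩ := key hq ht h'
    exact eq_of_frame hm hn hl hq ht ⟨y, hy⟩
      ⟨y * (2 * t + 3) - 4 * x, by linear_combination (2 * t + 3) * hy - 4 * hx⟩
  · obtain ⟨y, hy⟩ := (frame_iff hm hq ht).1 h'
    have h3 : (3 : ℤ) = q * (x - (x - y) * (t + 3)) := by
      linear_combination hx - (t + 3) * (hx - hy)
    exact eq_of_frame hm hn hl hq ht
      ⟨2 * (x - y) + (x - (x - y) * (t + 3)), by linear_combination 2 * (hx - hy) + h3⟩ ⟨_, h3⟩
  · obtain ⟨y, hy⟩ := key hq ht h'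
    exact eq_of_frame hm hn hl hq ht ⟨y, hy⟩
      ⟨y * (2 * t - 1) - 4 * x, by linear_combination (2 * t - 1) * hy - 4 * hx⟩
  · obtain ⟨y, hy⟩ := (frame_iff hm hq ht).1 h'
    have h3 : (3 : ℤ) = q * (x - (y - x) * (t - 2)) := by
      linear_combination hx - (t - 2) * (hy - hx)
    exact eq_of_frame hm hn hl hq ht
      ⟨2 * (y - x) - (x - (y - x) * (t - 2)), by linear_combination 2 * (hy - hx) - h3⟩ ⟨_, h3⟩
  · obtain ⟨y, hy⟩ := key hq ht h'
    exact eq_of_frame hm hn hl hq ht ⟨y, hy⟩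
      ⟨4 * x - y * (2 * t + 1), by linear_combination 4 * hx - (2 * t + 1) * hy⟩

end Frame

/-! ### Transitivity properties in terms of the colour permutations. -/

namespace HoneycombCover

variable {V : Type*} {G : SimpleGraph V} {Λ : AddSubgroup (Fin 3 → ℤ)} (C : HoneycombCover G Λ)

/-- All automorphisms are induced by symmetries of the honeycomb lattice. -/
def IsAffine : Prop :=
  ∀ (φ : G ≃g G) (p q : Fin 3 → ℤ), IsVertex p → IsVertex q → φ (C.proj p) = C.proj q →
    ∃ σ, PreservedBy Λ σ ∧ ∀ r, IsVertex r → φ (C.proj r) = C.proj (affine σ p q r)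

lemma exists_iso_step {σ : Equiv.Perm (Fin 3)} (hσ : PreservedBy Λ σ) {p q : Fin 3 → ℤ}
    (hp : IsVertex p) (hq : IsVertex q) :
    ∃ φ : G ≃g G, φ (C.proj p) = C.proj q ∧ ∀ s, φ (C.proj (step s p)) = C.proj (step (σ s) q) := by
  obtain ⟨φ, hφ⟩ := C.exists_iso hσ hp hq
  refine ⟨φ, by rw [hφ p hp, affine_self], fun s => ?_⟩
  rw [hφ _ (hp.step s), affine_step σ hp hq, affine_self]

lemma isVertex_zero : IsVertex 0 := Or.inl rfl

lemma exists_proj_step {u v : V} (h : G.Adj u v) :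
    ∃ p s, IsVertex p ∧ u = C.proj p ∧ v = C.proj (step s p) := by
  obtain ⟨p, hp, rfl⟩ := C.surj u
  obtain ⟨s, hs⟩ := (C.adj_iff p v hp).1 h
  exact ⟨p, s, hp, rfl, hs⟩

lemma adj_step {p : Fin 3 → ℤ} (hp : IsVertex p) (s : Fin 3) :
    G.Adj (C.proj p) (C.proj (step s p)) := (C.adj_iff _ _ hp).2 ⟨s, rfl⟩

variable {C}

lemma IsAffine.exists_perm (hC : C.IsAffine) (φ : G ≃g G) {p q : Fin 3 → ℤ} (hp : IsVertex p)
    (hq : IsVertex q) (h : φ (C.proj p) = C.proj q) :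
    ∃ σ, PreservedBy Λ σ ∧ ∀ s, φ (C.proj (step s p)) = C.proj (step (σ s) q) := by
  obtain ⟨σ, hσ, H⟩ := hC φ p q hp hq h
  refine ⟨σ, hσ, fun s => ?_⟩
  rw [H _ (hp.step s), affine_step σ hp hq, affine_self]

/-- An affine automorphism is determined by the image of one vertex and the colour permutation
there. -/
lemma IsAffine.ext (hC : C.IsAffine) {φ ψ : G ≃g G} {p q : Fin 3 → ℤ} (hp : IsVertex p)
    (hq : IsVertex q) (hφ : φ (C.proj p) = C.proj q) (hψ : ψ (C.proj p) = C.proj q)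
    (h : ∀ s, φ (C.proj (step s p)) = ψ (C.proj (step s p))) : φ = ψ := by
  obtain ⟨σ, -, H⟩ := hC φ p q hp hq hφ
  obtain ⟨τ, -, K⟩ := hC ψ p q hp hq hψ
  have : σ = τ := by
    ext s
    have := h s
    rw [H _ (hp.step s), K _ (hp.step s), affine_step σ hp hq, affine_step τ hp hq, affine_self,
      affine_self, C.proj_step_inj hq] at this
    rw [this]
  refine RelIso.ext fun u => ?_
  obtain ⟨r, hr, rfl⟩ := C.surj u
  rw [H r hr, K r hr, this]

lemma exists_perm_pair : ∀ s t s' t' : Fin 3, s ≠ t → s' ≠ t' →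
    ∃ σ : Equiv.Perm (Fin 3), σ s = s' ∧ σ t = t' := by
  decide

lemma perm_eq_of_pair {σ τ : Equiv.Perm (Fin 3)} {s t : Fin 3} (hst : s ≠ t) (hs : σ s = τ s)
    (ht : σ t = τ t) : σ = τ := by
  ext r
  by_cases h1 : r = s
  · rw [h1, hs]
  · by_cases h2 : r = t
    · rw [h2, ht]
    · have a := σ.injective.ne h1
      have b := σ.injective.ne h2
      have c := τ.injective.ne h1
      have d := τ.injective.ne h2
      have e := σ.injective.ne hst
      rw [hs] at a e
      rw [ht] at b e
      omega

lemma isSArc_one {p : Fin 3 → ℤ} (hp : IsVertex p) (s : Fin 3) :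
    IsSArc G 1 ![C.proj p, C.proj (step s p)] := by
  have h := C.adj_step hp s
  constructor <;> intro i j hij <;> fin_cases i <;> fin_cases j <;> simp at hij ⊢
  exact h

lemma isSArc_two {p : Fin 3 → ℤ} (hp : IsVertex p) {s t : Fin 3} (hst : s ≠ t) :
    IsSArc G 2 ![C.proj (step s p), C.proj p, C.proj (step t p)] := by
  have h1 := (C.adj_step hp s).symm
  have h2 := C.adj_step hp t
  have h3 := (C.proj_step_inj hp).not.2 hst
  constructor <;> intro i j hij <;> fin_cases i <;> fin_cases j <;> simp at hij ⊢ <;> assumption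

lemma fin_two_cases (i : Fin 2) : i = 0 ∨ i = 1 := by omega

lemma fin_three_cases (i : Fin 3) : i = 0 ∨ i = 1 ∨ i = 2 := by omega

lemma exists_of_isSArc_one {a : Fin 2 → V} (ha : IsSArc G 1 a) :
    ∃ p s, IsVertex p ∧ a 0 = C.proj p ∧ a 1 = C.proj (step s p) :=
  C.exists_proj_step (ha.1 0 1 rfl)

lemma exists_of_isSArc_two {a : Fin 3 → V} (ha : IsSArc G 2 a) :
    ∃ p s t, IsVertex p ∧ s ≠ t ∧ a 0 = C.proj (step s p) ∧ a 1 = C.proj p ∧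
      a 2 = C.proj (step t p) := by
  obtain ⟨p, t, hp, h1, h2⟩ := C.exists_proj_step (ha.1 1 2 rfl)
  have h01 := (ha.1 0 1 rfl).symm
  rw [h1] at h01
  obtain ⟨s, hs⟩ := (C.adj_iff _ _ hp).1 h01
  refine ⟨p, s, t, hp, ?_, hs, h1, h2⟩
  rintro rfl
  exact ha.2 0 2 rfl (by rw [hs, h2])

/-- A 2-arc is its middle vertex with an ordered pair of distinct colours, and S₃ acts regularly on
such pairs. -/
theorem IsAffine.isSArcRegular_two_iff (hC : C.IsAffine) :
    IsSArcRegular G 2 ↔ ∀ σ, PreservedBy Λ σ := by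
  constructor
  · intro h σ
    obtain ⟨φ, hφ, -⟩ := h _ _ (C.isSArc_two isVertex_zero (show (0 : Fin 3) ≠ 1 by decide))
      (C.isSArc_two isVertex_zero (σ.injective.ne (show (0 : Fin 3) ≠ 1 by decide)))
    have h0 := hφ 0
    have h1 := hφ 1
    have h2 := hφ 2
    simp only [Matrix.cons_val] at h0 h1 h2
    obtain ⟨τ, hτ, H⟩ := hC.exists_perm φ isVertex_zero isVertex_zero h1
    rw [H, C.proj_step_inj isVertex_zero] at h0 h2
    rwa [← perm_eq_of_pair (show (0 : Fin 3) ≠ 1 by decide) h0 h2]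
  · intro h a b ha hb
    obtain ⟨p, s, t, hp, hst, ha0, ha1, ha2⟩ := exists_of_isSArc_two (C := C) ha
    obtain ⟨q, s', t', hq, hst', hb0, hb1, hb2⟩ := exists_of_isSArc_two (C := C) hb
    obtain ⟨σ, hs, ht⟩ := exists_perm_pair s t s' t' hst hst'
    obtain ⟨φ, hφ, H⟩ := C.exists_iso_step (h σ) hp hq
    refine ⟨φ, fun i => ?_, fun ψ hψ => ?_⟩
    · rcases fin_three_cases i with rfl | rfl | rfl
      · rw [ha0, hb0, H, hs]
      · rw [ha1, hb1, hφ]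
      · rw [ha2, hb2, H, ht]
    · have h0 := hψ 0
      have h1 := hψ 1
      have h2 := hψ 2
      rw [ha0, hb0] at h0
      rw [ha1, hb1] at h1
      rw [ha2, hb2] at h2
      obtain ⟨τ, -, K⟩ := hC.exists_perm ψ hp hq h1
      rw [K, C.proj_step_inj hq] at h0 h2
      obtain rfl : τ = σ := perm_eq_of_pair hst (h0.trans hs.symm) (h2.trans ht.symm)
      exact hC.ext hp hq h1 hφ fun s => by rw [K, H]

theorem IsAffine.isSArcTransitive_one_iff (hC : C.IsAffine) :
    IsSArcTransitive G 1 ↔ ∀ s s', ∃ σ, PreservedBy Λ σ ∧ σ s = s' := by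
  constructor
  · intro h s s'
    obtain ⟨φ, hφ⟩ := h _ _ (C.isSArc_one isVertex_zero s) (C.isSArc_one isVertex_zero s')
    have h0 := hφ 0
    have h1 := hφ 1
    simp only [Matrix.cons_val] at h0 h1
    obtain ⟨τ, hτ, H⟩ := hC.exists_perm φ isVertex_zero isVertex_zero h0
    rw [H, C.proj_step_inj isVertex_zero] at h1
    exact ⟨τ, hτ, h1⟩
  · intro h a b ha hb
    obtain ⟨p, s, hp, ha0, ha1⟩ := exists_of_isSArc_one (C := C) ha
    obtain ⟨q, s', hq, hb0, hb1⟩ := exists_of_isSArc_one (C := C) hb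
    obtain ⟨σ, hσ, hs⟩ := h s s'
    obtain ⟨φ, hφ, H⟩ := C.exists_iso_step hσ hp hq
    refine ⟨φ, fun i => ?_⟩
    rcases fin_two_cases i with rfl | rfl
    · rw [ha0, hb0, hφ]
    · rw [ha1, hb1, H, hs]

theorem IsAffine.isSArcRegular_one_iff (hC : C.IsAffine) :
    IsSArcRegular G 1 ↔ ∀ s s', ∃! σ, PreservedBy Λ σ ∧ σ s = s' := by
  constructor
  · intro h s s'
    have huniq := h _ _ (C.isSArc_one isVertex_zero s) (C.isSArc_one isVertex_zero s')
    have hex : IsSArcTransitive G 1 := fun a b ha hb => (h a b ha hb).exists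
    obtain ⟨σ, hσ, hs⟩ := hC.isSArcTransitive_one_iff.1 hex s s'
    refine ⟨σ, ⟨hσ, hs⟩, fun τ ⟨hτ, ht⟩ => ?_⟩
    obtain ⟨φ, hφ, H⟩ := C.exists_iso_step hσ isVertex_zero isVertex_zero
    obtain ⟨ψ, hψ, K⟩ := C.exists_iso_step hτ isVertex_zero isVertex_zero
    have e : φ = ψ := by
      refine huniq.unique (fun i => ?_) fun i => ?_ <;>
        rcases fin_two_cases i with rfl | rfl
      · exact hφ
      · exact (H s).trans (by rw [hs]; rfl)
      · exact hψ
      · exact (K s).trans (by rw [ht]; rfl)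
    ext r
    have : σ r = τ r := (C.proj_step_inj isVertex_zero).1 ((H r).symm.trans (by rw [e, K r]))
    rw [this]
  · intro h a b ha hb
    have hex := hC.isSArcTransitive_one_iff.2 (fun s s' => (h s s').exists) a b ha hb
    obtain ⟨p, s, hp, ha0, ha1⟩ := exists_of_isSArc_one (C := C) ha
    obtain ⟨q, s', hq, hb0, hb1⟩ := exists_of_isSArc_one (C := C) hb
    refine existsUnique_of_exists_of_unique hex fun φ ψ hφ hψ => ?_
    have f0 := hφ 0
    have f1 := hφ 1
    have g0 := hψ 0
    have g1 := hψ 1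
    rw [ha0, hb0] at f0 g0
    rw [ha1, hb1] at f1 g1
    obtain ⟨σ, hσ, H⟩ := hC.exists_perm φ hp hq f0
    obtain ⟨τ, hτ, K⟩ := hC.exists_perm ψ hp hq g0
    rw [H, C.proj_step_inj hq] at f1
    rw [K, C.proj_step_inj hq] at g1
    obtain rfl := (h s s').unique ⟨hσ, f1⟩ ⟨hτ, g1⟩
    exact hC.ext hp hq f0 g0 fun s => by rw [H, K]

theorem IsAffine.card_stabilizer (hC : C.IsAffine) (v : V) :
    Nat.card (MulAction.stabilizer (G ≃g G) v) =
      Nat.card {σ : Equiv.Perm (Fin 3) // PreservedBy Λ σ} := by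
  obtain ⟨p, hp, rfl⟩ := C.surj v
  have hfix : ∀ φ : MulAction.stabilizer (G ≃g G) (C.proj p), φ.1 (C.proj p) = C.proj p :=
    fun φ => φ.2
  choose f hf hf' using fun φ : MulAction.stabilizer (G ≃g G) (C.proj p) =>
    hC.exists_perm φ.1 hp hp (hfix φ)
  refine Nat.card_congr (Equiv.ofBijective (fun φ => ⟨f φ, hf φ⟩) ⟨fun φ ψ h => ?_, ?_⟩)
  · have h' : f φ = f ψ := congrArg Subtype.val h
    exact Subtype.ext (hC.ext hp hp (hfix φ) (hfix ψ) fun s => by rw [hf', hf', h'])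
  · rintro ⟨σ, hσ⟩
    obtain ⟨φ, hφ, H⟩ := C.exists_iso_step hσ hp hp
    refine ⟨⟨φ, hφ⟩, Subtype.ext (Equiv.ext fun s => ?_)⟩
    rw [← C.proj_step_inj hp, ← hf', ← H]

theorem IsAffine.vertexStabilizersOfOrder_iff (hC : C.IsAffine) (k : ℕ) :
    VertexStabilizersOfOrder G k ↔ Nat.card {σ : Equiv.Perm (Fin 3) // PreservedBy Λ σ} = k := by
  constructor
  · intro h
    rw [← hC.card_stabilizer (C.proj 0), h]
  · intro h v
    rw [hC.card_stabilizer, h]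

/-- The identity permutation already provides transitivity on vertices, so only triviality of the
stabilizers is at stake. -/
theorem IsAffine.autRegular_iff (hC : C.IsAffine) :
    AutRegular G ↔ ∀ σ, PreservedBy Λ σ → σ = 1 := by
  constructor
  · intro h σ hσ
    obtain ⟨φ, hφ, H⟩ := C.exists_iso_step hσ isVertex_zero isVertex_zero
    obtain ⟨ψ, hψ, K⟩ := C.exists_iso_step (preservedBy_one Λ) isVertex_zero isVertex_zero
    obtain rfl := (h _ _).unique hφ hψ
    ext s
    rw [(C.proj_step_inj isVertex_zero).1 ((H s).symm.trans (K s))]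
  · intro h u v
    obtain ⟨p, hp, rfl⟩ := C.surj u
    obtain ⟨q, hq, rfl⟩ := C.surj v
    obtain ⟨φ, hφ, H⟩ := C.exists_iso_step (preservedBy_one Λ) hp hq
    refine ⟨φ, hφ, fun ψ hψ => ?_⟩
    obtain ⟨σ, hσ, K⟩ := hC.exists_perm ψ hp hq hψ
    obtain rfl := h σ hσ
    exact hC.ext hp hq hψ hφ fun s => by rw [K, H]

end HoneycombCover

/-! ### Subgroups of S₃, and the conclusion. -/

section PermutationGroup

variable {R : Equiv.Perm (Fin 3) → Prop} {c₁ c₂ c₃ c₄ : Prop}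

/-- The truth values of `R` on the six permutations of the colours. -/
structure PermTable (R : Equiv.Perm (Fin 3) → Prop) (c₁ c₂ c₃ c₄ : Prop) : Prop where
  one : R 1
  swap_one_two : R (Equiv.swap 1 2) ↔ c₁
  swap_zero_two : R (Equiv.swap 0 2) ↔ c₂
  swap_zero_one : R (Equiv.swap 0 1) ↔ c₃
  rotate : R rot ↔ c₄
  rotate_symm : R rot.symm ↔ c₄

namespace PermTable

lemma forall_iff (h : PermTable R c₁ c₂ c₃ c₄) : (∀ σ, R σ) ↔ c₁ ∧ c₂ ∧ c₃ ∧ c₄ := by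
  constructor
  · intro H
    exact ⟨h.2.1 (H _), h.3.1 (H _), h.4.1 (H _), h.5.1 (H _)⟩
  · rintro ⟨h1, h2, h3, h4⟩ σ
    rcases perm_cases σ with rfl | rfl | rfl | rfl | rfl | rfl
    exacts [h.1, h.4.2 h3, h.3.2 h2, h.2.2 h1, h.5.2 h4, h.6.2 h4]

lemma trivial_iff (h : PermTable R c₁ c₂ c₃ c₄) :
    (∀ σ, R σ → σ = 1) ↔ ¬c₁ ∧ ¬c₂ ∧ ¬c₃ ∧ ¬c₄ := by
  constructor
  · intro H
    refine ⟨fun c => ?_, fun c => ?_, fun c => ?_, fun c => ?_⟩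
    · exact absurd (H _ (h.2.2 c)) (by decide)
    · exact absurd (H _ (h.3.2 c)) (by decide)
    · exact absurd (H _ (h.4.2 c)) (by decide)
    · exact absurd (H _ (h.5.2 c)) (by decide)
  · rintro ⟨h1, h2, h3, h4⟩ σ hσ
    rcases perm_cases σ with rfl | rfl | rfl | rfl | rfl | rfl
    exacts [rfl, absurd (h.4.1 hσ) h3, absurd (h.3.1 hσ) h2, absurd (h.2.1 hσ) h1,
      absurd (h.5.1 hσ) h4, absurd (h.6.1 hσ) h4]

lemma or_of_transitive (h : PermTable R c₁ c₂ c₃ c₄) (H : ∀ s s', ∃ σ, R σ ∧ σ s = s') :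
    (c₃ ∨ c₄) ∧ (c₂ ∨ c₄) := by
  constructor
  · obtain ⟨σ, hσ, hs⟩ := H 0 1
    rcases perm_cases σ with rfl | rfl | rfl | rfl | rfl | rfl
    exacts [absurd hs (by decide), Or.inl (h.4.1 hσ), absurd hs (by decide), absurd hs (by decide),
      Or.inr (h.5.1 hσ), Or.inr (h.6.1 hσ)]
  · obtain ⟨σ, hσ, hs⟩ := H 0 2
    rcases perm_cases σ with rfl | rfl | rfl | rfl | rfl | rfl
    exacts [absurd hs (by decide), absurd hs (by decide), Or.inl (h.3.1 hσ), absurd hs (by decide),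
      Or.inr (h.5.1 hσ), Or.inr (h.6.1 hσ)]

/-- A transposition fixes a colour, as the identity does, so regularity excludes all three;
transitivity then needs the rotations, which act regularly on the colours. -/
lemma regular_iff (h : PermTable R c₁ c₂ c₃ c₄) (hall : AtLeastTwo c₁ c₂ c₃ c₄ → c₁ ∧ c₂ ∧ c₃ ∧ c₄) :
    (∀ s s', ∃! σ, R σ ∧ σ s = s') ↔ c₄ ∧ ¬c₁ ∧ ¬c₂ ∧ ¬c₃ := by
  constructor
  · intro H
    have n1 : ¬c₁ := fun c => absurd ((H 0 0).unique ⟨h.1, rfl⟩ ⟨h.2.2 c, by decide⟩) (by decide)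
    have n2 : ¬c₂ := fun c => absurd ((H 1 1).unique ⟨h.1, rfl⟩ ⟨h.3.2 c, by decide⟩) (by decide)
    have n3 : ¬c₃ := fun c => absurd ((H 2 2).unique ⟨h.1, rfl⟩ ⟨h.4.2 c, by decide⟩) (by decide)
    have := h.or_of_transitive fun s s' => (H s s').exists
    tauto
  · rintro ⟨h4, h1, h2, h3⟩
    have key : ∀ σ, R σ ↔ σ = 1 ∨ σ = rot ∨ σ = rot.symm := by
      intro σ
      constructor
      · intro hσ
        rcases perm_cases σ with rfl | rfl | rfl | rfl | rfl | rfl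
        exacts [Or.inl rfl, absurd (h.4.1 hσ) h3, absurd (h.3.1 hσ) h2, absurd (h.2.1 hσ) h1,
          Or.inr (Or.inl rfl), Or.inr (Or.inr rfl)]
      · rintro (rfl | rfl | rfl)
        exacts [h.1, h.5.2 h4, h.6.2 h4]
    simp only [key]
    unfold ExistsUnique
    decide

open Classical in
lemma card_eq (h : PermTable R c₁ c₂ c₃ c₄) : Nat.card {σ // R σ} =
    1 + (if c₁ then 1 else 0) + (if c₂ then 1 else 0) + (if c₃ then 1 else 0) +
      (if c₄ then 2 else 0) := by
  have huniv : (Finset.univ : Finset (Equiv.Perm (Fin 3))) =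
      {1, Equiv.swap 1 2, Equiv.swap 0 2, Equiv.swap 0 1, rot, rot.symm} := by
    ext σ
    have := perm_cases σ
    simp only [Finset.mem_univ, Finset.mem_insert, Finset.mem_singleton, true_iff]
    tauto
  rw [Nat.card_eq_fintype_card, Fintype.card_subtype, Finset.card_filter, huniv]
  rw [Finset.sum_insert, Finset.sum_insert, Finset.sum_insert, Finset.sum_insert,
    Finset.sum_insert, Finset.sum_singleton]
  · simp only [h.1, h.2, h.3, h.4, h.5, show R (Equiv.symm rot) ↔ c₄ from h.6]
    split_ifs <;> rfl
  all_goals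
    simp only [Finset.mem_insert, Finset.mem_singleton]
    decide

/-- Order 2 means one transposition and no rotation. Conversely, one transposition alone excludes
the rotations by `hall`, and a group of order 2 is not transitive on three colours. -/
lemma exactlyOne_iff (h : PermTable R c₁ c₂ c₃ c₄)
    (hall : AtLeastTwo c₁ c₂ c₃ c₄ → c₁ ∧ c₂ ∧ c₃ ∧ c₄) :
    (¬(∀ s s', ∃ σ, R σ ∧ σ s = s') ∧ Nat.card {σ // R σ} = 2) ↔ ExactlyOne c₁ c₂ c₃ := by
  classical
  rw [h.card_eq]
  constructor
  · rintro ⟨-, hcard⟩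
    unfold ExactlyOne
    by_cases h1 : c₁ <;> by_cases h2 : c₂ <;> by_cases h3 : c₃ <;> by_cases h4 : c₄ <;>
      simp_all
  · intro hone
    have h4 : ¬c₄ := by
      unfold ExactlyOne AtLeastTwo at *
      tauto
    refine ⟨fun H => ?_, ?_⟩
    · have := h.or_of_transitive H
      unfold ExactlyOne at *
      tauto
    · unfold ExactlyOne at hone
      rcases hone with ⟨h1, h2, h3⟩ | ⟨h1, h2, h3⟩ | ⟨h1, h2, h3⟩ <;> simp [h1, h2, h3, h4]

end PermTable

end PermutationGroup

theorem theorem2 (m n l : ℕ) (hm : 1 ≤ m) (hn : 4 ≤ n) (hn_even : Even n)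
    (hl : l ≤ n / 2) (hparity : l % 2 = m % 2)
    (hcubic : ¬(m = 1 ∧ l = 1))
    (hexc : ¬IsExceptional m n l) :
    -- 2-arc-regular graphs
    ((IsSArcRegular (HTG m n l) 2 ↔
        AtLeastTwo (C1 m n l) (C2 m n l) (C3 n l) (C4 m n l)) ∧
      (AtLeastTwo (C1 m n l) (C2 m n l) (C3 n l) (C4 m n l) ↔
        (C1 m n l ∧ C2 m n l ∧ C3 n l ∧ C4 m n l)) ∧
      (IsSArcRegular (HTG m n l) 2 ↔
        ((4 ≤ m ∧ n = 2 * m ∧ l = m) ∨ (2 ≤ m ∧ n = 6 * m ∧ l = 3 * m)))) ∧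
    -- 1-arc-regular graphs
    (IsSArcRegular (HTG m n l) 1 ↔
      (C4 m n l ∧ ¬C1 m n l ∧ ¬C2 m n l ∧ ¬C3 n l)) ∧
    -- not arc-transitive, with vertex stabilizers of order 2
    ((¬IsSArcTransitive (HTG m n l) 1 ∧ VertexStabilizersOfOrder (HTG m n l) 2) ↔
      ExactlyOne (C1 m n l) (C2 m n l) (C3 n l)) ∧
    -- regular automorphism group
    (AutRegular (HTG m n l) ↔
      (¬C1 m n l ∧ ¬C2 m n l ∧ ¬C3 n l ∧ ¬C4 m n l)) := by
  have C := htgCover hm hn hn_even hparity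
    (single_sub_single_notMem hm hn hn_even hl hparity hcubic hexc)
  obtain ⟨j, hj⟩ := exists_locallyRigid hm hn hn_even hl hparity hcubic hexc
  have hC : C.IsAffine := fun φ p q hp hq h => C.eq_affine (htgClosed_iff hm) hj φ hp hq h
  have hrot : PreservedBy (htgLattice m n l) rot ↔ C4 m n l := by
    rw [c4_iff hm, preservedBy_rot_iff hm hn_even hparity]
  have T : PermTable (PreservedBy (htgLattice m n l)) (C1 m n l) (C2 m n l) (C3 n l) (C4 m n l) :=
    { one := preservedBy_one _
      swap_one_two := by rw [c1_iff hm, preservedBy_swap_one_two_iff hm hn_even hparity]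
      swap_zero_two := by rw [c2_iff hm, preservedBy_swap_zero_two_iff hm hn_even hparity]
      swap_zero_one := by rw [c3_iff hn hn_even hl, preservedBy_swap_zero_one_iff hm hn_even hparity]
      rotate := hrot
      rotate_symm := by rw [preservedBy_symm_iff, hrot] }
  have hlist : AtLeastTwo (C1 m n l) (C2 m n l) (C3 n l) (C4 m n l) ↔
      (n = 2 * m ∧ l = m) ∨ (n = 6 * m ∧ l = 3 * m) := by
    refine ⟨eq_of_atLeastTwo hm hn hn_even hl, fun h => ?_⟩
    obtain ⟨h1, h2, -⟩ := all_of_eq hm h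
    exact Or.inl ⟨h1, h2⟩
  have hall : AtLeastTwo (C1 m n l) (C2 m n l) (C3 n l) (C4 m n l) ↔
      (C1 m n l ∧ C2 m n l ∧ C3 n l ∧ C4 m n l) :=
    ⟨fun h => all_of_eq hm (hlist.1 h), fun h => Or.inl ⟨h.1, h.2.1⟩⟩
  -- The small members drop out: n = 2m with m = 1 violates n ≥ 4, and HTG(2,4,2), HTG(3,6,3) and
  -- HTG(1,6,3) are exceptional.
  have hfam : ((n = 2 * m ∧ l = m) ∨ (n = 6 * m ∧ l = 3 * m)) ↔
      ((4 ≤ m ∧ n = 2 * m ∧ l = m) ∨ (2 ≤ m ∧ n = 6 * m ∧ l = 3 * m)) := by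
    unfold IsExceptional at hexc
    simp only [not_or] at hexc
    obtain ⟨e1, ⟨-, e3, -⟩, -, -, e8, -⟩ := hexc
    omega
  have hreg := hC.isSArcRegular_two_iff.trans T.forall_iff
  refine ⟨⟨hreg.trans hall.symm, hall, ?_⟩, ?_, ?_, ?_⟩
  · rw [hreg, ← hall, hlist, hfam]
  · rw [hC.isSArcRegular_one_iff, T.regular_iff hall.1]
  · rw [hC.isSArcTransitive_one_iff, hC.vertexStabilizersOfOrder_iff, T.exactlyOne_iff hall.1]
  · rw [hC.autRegular_iff, T.trivial_iff]
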